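/- Let $\mathbb H$ be the quaternions, $Q^*=\bar Q^{t}$, and $$Sp(2)=\Big\{Q=\begin{pmatrix} a& b\\ c& d\end{pmatrix}\in M(2,\mathbb H)\ :\ QQ^*=I\Big\}.$$ This is a $10$-dimensional embedded smooth submanifold of $M(2,\mathbb H)$ with $$T_I\,Sp(2)=\mathfrak{sp}(2)=\Big\{\begin{pmatrix} x& y\\ -\bar y& z\end{pmatrix}\ :\ \mathrm{Re}(x)=\mathrm{Re}(z)=0\Big\}.$$ Equip $Sp(2)$ with the left invariant Riemannian metric $\langle\cdot,\cdot\rangle$ which at $I$ is given by $$\left|\begin{pmatrix} x& y\\ -\bar y& z\end{pmatrix}\right|^2=|x|^2+|y|^2+|z|^2 ,$$ let $\nabla$ denote its Levi-Civita connection (and also the gradient), and let $\triangle f$ be the trace of the Hessian $u\mapsto\nabla_u\nabla f$. A non-constant smooth function $f$ on a Riemannian manifold $N$ is called *isoparametric* if $|\nabla f|^2=\beta(f)$ for some smooth $\beta:\mathbb R\to\mathbb R$ and $\triangle f=\alpha(f)$ for some continuous $\alpha:\mathbb R\to\mathbb R$. It is *properly* isoparametric if moreover its focal varieties, i.e. the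 sets $M_+$ and $M_-$ where $f$ attains its global maximum and its global minimum, are submanifolds of codimension at least $2$ in $N$; these are then called the focal submanifolds. **Theorem.** The function $F:Sp(2)\to\mathbb R$, $F(Q)=\mathrm{Re}(a)$, is properly isoparametric on $(Sp(2),\langle\cdot,\cdot\rangle)$. In fact $$|\nabla F|^2=1-F^2,\qquad \triangle F=-7F .$$ The image of $F$ is $[-1,1]$. For $-1<t<1$ the level set $M_t=F^{-1}(t)$ is a $9$-dimensional submanifold (a hypersurface), and with respect to the unit normal $\nu=\nabla F/|\nabla F|$ and the shape operator $A_\nu u=-\nabla_u\nu$ its principal curvatures at $Q=\begin{pmatrix} a& b\\ c& d\end{pmatrix}\in M_t$ are $$\lambda_1(Q)=\frac{t}{\sqrt{1-t^2}},\qquad \lambda_2(Q)=\frac{t+\sqrt{t^2+4|b|^2}}{2\sqrt{1-t^2}},\qquad \lambda_3(Q)=\frac{t-\sqrt{t^2+4|b|^2}}{2\sqrt{1-t^2}},$$ each with multiplicity $3$. They are pairwise distinct if and only if $b\neq 0$; when some of them coincide the multiplicities add up. That is, for every real $\mu$ the space $\{u\in T_QM_t: A_\nu u=\mu u\}$ has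 dimension $3\cdot\#\{i:\lambda_i(Q)=\mu\}$. Finally, the critical set of $F$ is $M_+\cup M_-$, where the focal submanifolds $M_{\pm}=M_{\pm1}$ are $$M_{\pm1}=F^{-1}(\pm1)=\Big\{\begin{pmatrix}\pm1&0\\0&d\end{pmatrix}\ :\ d\in\mathbb H,\ |d|=1\Big\},$$ and each of them is diffeomorphic to $S^3$. -/

import Mathlib

open Set Topology
open scoped ContDiff Matrix Quaternion

attribute [local instance] Matrix.linftyOpNormedRing Matrix.linftyOpNormedAlgebra

/-! ## Submanifolds of a vector space and their calculus

A smooth manifold is presented here as a subset `N` of a finite dimensional real normed space `E`,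
with smooth maps, tangent vectors and derivatives taken relative to `N`:

* a map is smooth on `N` if it is `ContDiffOn ℝ ∞` on the set `N`;
* the tangent space `T_p N` is spanned by the tangent cone of the set `N` at `p`;
* the derivative of `f` at `p` in the direction `v ∈ T_p N` is `fderivWithin ℝ f N p v` (derivatives
  within `N` are determined on the tangent cone, hence on `T_p N`, and only tangent
  directions are ever used below). -/

namespace EmbeddedGeometry

section Manifolds

variable {E E' : Type*} [NormedAddCommGroup E] [NormedSpace ℝ E]
  [NormedAddCommGroup E'] [NormedSpace ℝ E']

/-- The subsets `A` and `B` are diffeomorphic. -/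
def AreDiffeomorphic (A : Set E) (B : Set E') : Prop :=
  ∃ (φ : E → E') (ψ : E' → E), ContDiffOn ℝ ∞ φ A ∧ ContDiffOn ℝ ∞ ψ B ∧
    MapsTo φ A B ∧ MapsTo ψ B A ∧ InvOn ψ φ A B

/-- Near its point `p`, the set `M` is an embedded smooth submanifold of dimension `k`: a relatively
open neighbourhood of `p` in `M` is diffeomorphic to an open subset of `ℝᵏ`. -/
def IsSubmanifoldAt (k : ℕ) (M : Set E) (p : E) : Prop :=
  ∃ (U : Set E) (V : Set (EuclideanSpace ℝ (Fin k))), IsOpen U ∧ p ∈ U ∧ IsOpen V ∧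
    AreDiffeomorphic V (M ∩ U)

/-- The tangent space `T_p N`. -/
def tangentSpace (N : Set E) (p : E) : Submodule ℝ E :=
  Submodule.span ℝ (tangentConeAt ℝ N p)

/-- `X` is a smooth vector field on the open subset `N ∩ U` of `N` (for `U` open in `E`). The values
of `X` outside `N ∩ U` are irrelevant. -/
structure IsSmoothField (N U : Set E) (X : E → E) : Prop where
  tangent : ∀ p ∈ N ∩ U, X p ∈ tangentSpace N p
  smooth : ContDiffOn ℝ ∞ X (N ∩ U)

/-- `g` is a smooth Riemannian metric on the smooth `n`-dimensional submanifold `N`. Only the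
restriction of `g p` to `T_p N`, for `p ∈ N`, is meaningful. -/
structure IsRiemannianSubmanifold (n : ℕ) (N : Set E) (g : E → LinearMap.BilinForm ℝ E) : Prop where
  submanifold : ∀ p ∈ N, IsSubmanifoldAt n N p
  symm : ∀ p ∈ N, ∀ u ∈ tangentSpace N p, ∀ v ∈ tangentSpace N p, g p u v = g p v u
  pos : ∀ p ∈ N, ∀ u ∈ tangentSpace N p, u ≠ 0 → 0 < g p u u
  smooth : ∀ (U : Set E) (X Y : E → E), IsOpen U → IsSmoothField N U X → IsSmoothField N U Y →
    ContDiffOn ℝ ∞ (fun p => g p (X p) (Y p)) (N ∩ U)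

/-! ## The Levi-Civita connection -/

/-- The type of operators `(Y, p, u) ↦ ∇_u Y (p)`, linear in `u ∈ T_p N` and with values
in `T_p N`. -/
abbrev ConnectionOperator (N : Set E) : Type _ :=
  (E → E) → (p : E) → (tangentSpace N p →ₗ[ℝ] tangentSpace N p)

/-- `D` is the Levi-Civita connection of `(N, g)`: an affine connection which is torsion free and
compatible with the metric. It acts on vector fields defined on arbitrary open subsets
of `N`. -/
structure IsLeviCivita (N : Set E) (g : E → LinearMap.BilinForm ℝ E)
    (D : ConnectionOperator N) : Prop where
  smooth : ∀ (U : Set E) (X Y Z : E → E), IsOpen U → ∀ (hX : IsSmoothField N U X),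
    IsSmoothField N U Y →
    (∀ (p : E) (hp : p ∈ N ∩ U), Z p = D Y p ⟨X p, hX.tangent p hp⟩) →
    ContDiffOn ℝ ∞ Z (N ∩ U)
  add : ∀ (U : Set E) (Y Z : E → E), IsOpen U → IsSmoothField N U Y → IsSmoothField N U Z →
    ∀ p ∈ N ∩ U, ∀ u : tangentSpace N p, D (Y + Z) p u = D Y p u + D Z p u
  leibniz : ∀ (U : Set E) (f : E → ℝ) (Y : E → E), IsOpen U → ContDiffOn ℝ ∞ f (N ∩ U) →
    IsSmoothField N U Y → ∀ p ∈ N ∩ U, ∀ u : tangentSpace N p,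
    (D (fun q => f q • Y q) p u : E) = f p • (D Y p u : E) + (fderivWithin ℝ f N p u) • Y p
  torsion_free : ∀ (U : Set E) (X Y : E → E), IsOpen U → ∀ (hX : IsSmoothField N U X)
    (hY : IsSmoothField N U Y) (p : E) (hp : p ∈ N ∩ U),
    (D Y p ⟨X p, hX.tangent p hp⟩ : E) - (D X p ⟨Y p, hY.tangent p hp⟩ : E)
      = VectorField.lieBracketWithin ℝ X Y N p
  metric : ∀ (U : Set E) (Y Z : E → E), IsOpen U → IsSmoothField N U Y → IsSmoothField N U Z →
    ∀ p ∈ N ∩ U, ∀ u : tangentSpace N p,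
    fderivWithin ℝ (fun q => g q (Y q) (Z q)) N p u
      = g p (D Y p u) (Z p) + g p (Y p) (D Z p u)

/-- The Levi-Civita connection of `(N, g)`. -/
noncomputable def leviCivita (N : Set E) (g : E → LinearMap.BilinForm ℝ E) :
    ConnectionOperator N :=
  Classical.epsilon (IsLeviCivita N g)

/-! ## Gradient, Laplacian, second fundamental form -/

/-- The gradient `∇f` at `p`: the tangent vector with `⟨∇f, v⟩ = df(v)` for all `v ∈ T_p N`. -/
noncomputable def riemGradient (N : Set E) (g : E → LinearMap.BilinForm ℝ E) (f : E → ℝ) (p : E) : E :=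
  Classical.epsilon fun w : E => w ∈ tangentSpace N p ∧
    ∀ v ∈ tangentSpace N p, g p w v = fderivWithin ℝ f N p v

/-- The squared length `|∇f|²` at `p`. -/
noncomputable def gradNormSq (N : Set E) (g : E → LinearMap.BilinForm ℝ E) (f : E → ℝ) (p : E) :
    ℝ :=
  g p (riemGradient N g f p) (riemGradient N g f p)

/-- The Laplacian `Δf` at `p`: the trace of the Hessian `u ↦ ∇_u ∇f` on `T_p N`. -/
noncomputable def laplacian (N : Set E) (g : E → LinearMap.BilinForm ℝ E) (f : E → ℝ) (p : E) :
    ℝ :=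
  LinearMap.trace ℝ (tangentSpace N p) (leviCivita N g (riemGradient N g f) p)

/-- The normal field `ν = ∇f / |∇f|` of the regular level hypersurfaces of `f`. -/
noncomputable def unitNormal (N : Set E) (g : E → LinearMap.BilinForm ℝ E) (f : E → ℝ) (p : E) :
    E :=
  (Real.sqrt (gradNormSq N g f p))⁻¹ • riemGradient N g f p

/-- For a hypersurface `M ⊆ N` with unit normal field `ν` (extended to a neighbourhood in `N`), the
space of the `u ∈ T_p M` with `A_ν u = μ u`, where `A_ν u = -∇_u ν` is the shape operator. The
number `μ` is a principal curvature of `M` at `p` if this space is nonzero, and its dimension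
is the multiplicity of `μ`. -/
noncomputable def principalSpace (N : Set E) (g : E → LinearMap.BilinForm ℝ E) (M : Set E)
    (ν : E → E) (p : E) (μ : ℝ) : Submodule ℝ (tangentSpace N p) :=
  Module.End.eigenspace (-(leviCivita N g ν p)) μ ⊓
    (tangentSpace M p).comap (tangentSpace N p).subtype

/-! ## Isoparametric functions -/

/-- `f` is a transnormal function on `(N, g)`: smooth, not constant, with `|∇f|² = b(f)` for a smooth
function `b`. -/
def IsTransnormal (N : Set E) (g : E → LinearMap.BilinForm ℝ E) (f : E → ℝ) : Prop :=
  (∃ p ∈ N, ∃ q ∈ N, f p ≠ f q) ∧ ContDiffOn ℝ ∞ f N ∧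
    ∃ b : ℝ → ℝ, ContDiff ℝ ∞ b ∧ ∀ p ∈ N, gradNormSq N g f p = b (f p)

/-- `f` is an isoparametric function: transnormal with `Δf = a(f)` for a continuous
function `a`. -/
def IsIsoparametric (N : Set E) (g : E → LinearMap.BilinForm ℝ E) (f : E → ℝ) : Prop :=
  IsTransnormal N g f ∧
    ∃ a : ℝ → ℝ, Continuous a ∧ ∀ p ∈ N, laplacian N g f p = a (f p)

/-- `M₊`, the set where `f` attains its global maximum over `N`. -/
def maxSet (N : Set E) (f : E → ℝ) : Set E := {p ∈ N | IsMaxOn f N p}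

/-- `M₋`, the set where `f` attains its global minimum over `N`. -/
def minSet (N : Set E) (f : E → ℝ) : Set E := {p ∈ N | IsMinOn f N p}

/-- The critical set of `f`, where `∇f = 0`. -/
def criticalSet (N : Set E) (g : E → LinearMap.BilinForm ℝ E) (f : E → ℝ) : Set E :=
  {p ∈ N | riemGradient N g f p = 0}

/-- `f` is a properly isoparametric function: isoparametric, and its focal varieties `M₊ ∪ M₋` are
submanifolds of codimension at least `2` in `N`. -/
def IsProperlyIsoparametric (N : Set E) (g : E → LinearMap.BilinForm ℝ E) (f : E → ℝ) : Prop :=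
  IsIsoparametric N g f ∧
    ∀ p ∈ maxSet N f ∪ minSet N f, ∃ k : ℕ, k + 2 ≤ Module.finrank ℝ (tangentSpace N p) ∧
      IsSubmanifoldAt k (maxSet N f ∪ minSet N f) p

end Manifolds

/-! ## The group `Sp(2)` -/

/-- `M(2, ℍ)`. -/
abbrev QuatMat : Type := Matrix (Fin 2) (Fin 2) ℍ[ℝ]

/-- `Sp(2)`, as a subset of `M(2, ℍ)`. -/
def Sp2 : Set QuatMat := {Q | Q * Qᴴ = 1}

/-- `𝔰𝔭(2)`, the matrices with rows `(x, y)` and `(-ȳ, z)` where `Re x = Re z = 0`. -/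
def sp2 : Set QuatMat :=
  {ξ | (ξ 0 0).re = 0 ∧ (ξ 1 1).re = 0 ∧ ξ 1 0 = -star (ξ 0 1)}

/-- The left invariant metric `⟨u, v⟩_Q = ⟨Q* u, Q* v⟩_I`, where `Q* = Q⁻¹` and, for `ξ` in `𝔰𝔭(2)` with
rows `(x, y)` and `(-ȳ, z)`, `⟨ξ, ξ⟩_I = |x|² + |y|² + |z|²`. -/
noncomputable def sp2Metric (Q : QuatMat) : LinearMap.BilinForm ℝ QuatMat :=
  LinearMap.mk₂ ℝ
    (fun u v => inner ℝ ((Qᴴ * u) 0 0) ((Qᴴ * v) 0 0) + inner ℝ ((Qᴴ * u) 0 1) ((Qᴴ * v) 0 1)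
      + inner ℝ ((Qᴴ * u) 1 1) ((Qᴴ * v) 1 1))
    (by intro u u' v; simp only [Matrix.mul_add, Matrix.add_apply, inner_add_left]; ring)
    (by intro c u v
        simp only [Matrix.mul_smul, Matrix.smul_apply, real_inner_smul_left, smul_eq_mul]; ring)
    (by intro u v v'; simp only [Matrix.mul_add, Matrix.add_apply, inner_add_right]; ring)
    (by intro c u v
        simp only [Matrix.mul_smul, Matrix.smul_apply, real_inner_smul_right, smul_eq_mul]; ring)

/-- The function `F(Q) = Re(a)`, where `(a, b)` is the first row of `Q`. -/
def reA (Q : QuatMat) : ℝ := (Q 0 0).re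

/-- The level set `M_t` of `F` in `Sp(2)`. -/
def levelSet (t : ℝ) : Set QuatMat := {Q ∈ Sp2 | reA Q = t}

/-- The three principal curvatures `λ₁, λ₂, λ₃` of `M_t` at `Q`, with `b` the upper right
entry of `Q`. -/
noncomputable def curvatures (t : ℝ) (Q : QuatMat) : Fin 3 → ℝ :=
  ![t / √(1 - t ^ 2),
    (t + √(t ^ 2 + 4 * ‖Q 0 1‖ ^ 2)) / (2 * √(1 - t ^ 2)),
    (t - √(t ^ 2 + 4 * ‖Q 0 1‖ ^ 2)) / (2 * √(1 - t ^ 2))]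

end EmbeddedGeometry

open EmbeddedGeometry

/-! Everything is computed in the left trivialization: a tangent vector at `Q` is written `u = Qξ`
with `ξ = Q*u` in `𝔰𝔭(2)`, having entries `x, y, z`. The metric becomes the constant form `|x|² +
|y|² + |z|²`, and the Levi-Civita connection becomes differentiation of coordinates plus a bilinear
correction `invConn`. Since `leviCivita` is a choice, `isLeviCivita_sp2Connection` supplies
existence and `IsLeviCivita.apply_eq` uniqueness; together they give the formula
`leviCivita_Sp2_apply` on smooth fields.

Let `(a, b)` be the first row of `Q` and `t = Re a`. Then `dF(Qξ) = Re(ax - b ȳ)`, so the gradient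
has coordinates `(-Im a, -b, 0)`, and `|a|² + |b|² = 1` gives `|∇F|² = 1 - t²`. By `hessian_eq` the
Hessian is `(x, y, z) ↦ (-tx, -ty - bz, -Im(b̄ y))`, whose trace is `-3t - 4t = -7t`.

On a regular level the shape operator is minus the Hessian divided by `√(1 - t²)`, restricted to
`Re(ax - b ȳ) = 0`. An eigenvector of the rescaled operator with eigenvalue `m ≠ t` has `x = 0` and
`(m - t)y = bz`, hence `|b|² z = m(m - t) z`: the roots of this quadratic give `λ₂` and `λ₃`, each
with the three-dimensional freedom of `z`. The case `m = t` gives `λ₁`; it is three-dimensional if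
`b ≠ 0` and absorbs coincident roots if `b = 0` (`finrank_shapeEigenspace`).

If `t = ±1`, the first row must be `(±1, 0)`, which leaves a unit quaternion in the lower right
corner: the focal sets are 3-spheres. -/

namespace EmbeddedGeometry

/-! ### Derivatives within a subset, and regular level sets -/

section RegularLevelSets

variable {E G : Type*} [NormedAddCommGroup E] [NormedSpace ℝ E]
  [NormedAddCommGroup G] [NormedSpace ℝ G]

/-- A derivative within a thin set is not unique as a map on `E`, but its values on the tangent cone
are forced, hence so are those on the span. This makes every `fderivWithin` below computable from
any convenient derivative. -/
theorem HasFDerivWithinAt.eq_of_mem_tangentSpace {F : Type*} [NormedAddCommGroup F]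
    [NormedSpace ℝ F] {f : E → F} {A B : E →L[ℝ] F} {M : Set E} {p u : E}
    (hA : HasFDerivWithinAt f A M p) (hB : HasFDerivWithinAt f B M p)
    (hu : u ∈ tangentSpace M p) : A u = B u := by
  have : tangentSpace M p ≤ LinearMap.eqLocus (A : E →ₗ[ℝ] F) (B : E →ₗ[ℝ] F) :=
    Submodule.span_le.2 fun y hy => hA.unique_on hB hy
  exact this hu

theorem fderivWithin_apply_of_mem_tangentSpace {F : Type*} [NormedAddCommGroup F]
    [NormedSpace ℝ F] {f : E → F} {A : E →L[ℝ] F} {M : Set E} {p u : E}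
    (hA : HasFDerivWithinAt f A M p) (hu : u ∈ tangentSpace M p) :
    fderivWithin ℝ f M p u = A u :=
  hA.differentiableWithinAt.hasFDerivWithinAt.eq_of_mem_tangentSpace hA hu

/-- Near `p`, the set `M` is a smooth retract of its neighbourhood. -/
def HasLocalRetraction (M : Set E) (p : E) : Prop :=
  ∃ (U : Set E) (r : E → E), IsOpen U ∧ p ∈ U ∧ ContDiffOn ℝ ∞ r U ∧ MapsTo r U M ∧
    ∀ x ∈ M ∩ U, r x = x

/-- Directional derivatives, along smooth tangent fields, of a function that is smooth on a
submanifold are smooth. -/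
theorem contDiffOn_fderivWithin_apply_field {F : Type*} [NormedAddCommGroup F] [NormedSpace ℝ F]
    {M W : Set E} (hM : ∀ p ∈ M, HasLocalRetraction M p) (hW : IsOpen W) {f : E → F} {X : E → E}
    (hf : ContDiffOn ℝ ∞ f (M ∩ W)) (hX : IsSmoothField M W X) :
    ContDiffOn ℝ ∞ (fun p => fderivWithin ℝ f M p (X p)) (M ∩ W) := by
  rintro p ⟨hpM, hpW⟩
  obtain ⟨U, r, hU, hpU, hr, hrM, hrid⟩ := hM p hpM
  have hO : IsOpen (U ∩ r ⁻¹' W) := hr.continuousOn.isOpen_inter_preimage hU hW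
  have hpO : p ∈ U ∩ r ⁻¹' W := ⟨hpU, by rwa [mem_preimage, hrid p ⟨hpM, hpU⟩]⟩
  -- Composing with the retraction extends `f` to an open set, where the ordinary derivative is
  -- smooth; on tangent vectors it agrees with the derivative within `M`.
  have hfr : ContDiffOn ℝ ∞ (f ∘ r) (U ∩ r ⁻¹' W) :=
    hf.comp (hr.mono inter_subset_left) fun x hx => ⟨hrM hx.1, hx.2⟩
  have hfr' : ContDiffOn ℝ ∞ (fderiv ℝ (f ∘ r)) (U ∩ r ⁻¹' W) := hfr.fderiv_of_isOpen hO le_rfl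
  have hsm : ContDiffWithinAt ℝ ∞ (fun q => fderiv ℝ (f ∘ r) q (X q)) (M ∩ W) p :=
    ((hfr'.contDiffAt (hO.mem_nhds hpO)).contDiffWithinAt).clm_apply (hX.smooth p ⟨hpM, hpW⟩)
  have key : ∀ q ∈ M ∩ W, q ∈ U ∩ r ⁻¹' W →
      fderivWithin ℝ f M q (X q) = fderiv ℝ (f ∘ r) q (X q) := by
    intro q hq hqO
    refine fderivWithin_apply_of_mem_tangentSpace ?_ (hX.tangent q hq)
    have hd : HasFDerivWithinAt (f ∘ r) (fderiv ℝ (f ∘ r) q) (M ∩ (U ∩ r ⁻¹' W)) q :=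
      ((hfr.contDiffAt (hO.mem_nhds hqO)).differentiableAt (by simp)).hasFDerivAt.hasFDerivWithinAt
    refine (hasFDerivWithinAt_inter (hO.mem_nhds hqO)).1 (hd.congr (fun x hx => ?_) ?_)
    · rw [Function.comp_apply, hrid x ⟨hx.1, hx.2.1⟩]
    · rw [Function.comp_apply, hrid q ⟨hq.1, hqO.1⟩]
  refine hsm.congr_of_eventuallyEq ?_ (key p ⟨hpM, hpW⟩ hpO)
  filter_upwards [self_mem_nhdsWithin, mem_nhdsWithin_of_mem_nhds (hO.mem_nhds hpO)] with q hq hqO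
  exact key q hq hqO

variable [FiniteDimensional ℝ E] [FiniteDimensional ℝ G]

/-- A surjective linear map between finite dimensional spaces can be completed to an isomorphism. -/
theorem exists_prod_equiv_of_surjective {k : ℕ} (L : E →L[ℝ] G) (hL : Function.Surjective L)
    (hk : Module.finrank ℝ E = Module.finrank ℝ G + k) :
    ∃ (π : E →L[ℝ] EuclideanSpace ℝ (Fin k)) (e : E ≃L[ℝ] G × EuclideanSpace ℝ (Fin k)),
      (e : E →L[ℝ] G × EuclideanSpace ℝ (Fin k)) = L.prod π := by
  have hrn := LinearMap.finrank_range_add_finrank_ker (L : E →ₗ[ℝ] G)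
  rw [LinearMap.range_eq_top.2 hL, finrank_top] at hrn
  have hker : Module.finrank ℝ (LinearMap.ker (L : E →ₗ[ℝ] G))
      = Module.finrank ℝ (EuclideanSpace ℝ (Fin k)) := by
    rw [finrank_euclideanSpace_fin]; omega
  obtain ⟨c⟩ := FiniteDimensional.nonempty_continuousLinearEquiv_of_finrank_eq hker
  obtain ⟨q, hq⟩ := LinearMap.exists_leftInverse_of_injective
    (LinearMap.ker (L : E →ₗ[ℝ] G)).subtype (Submodule.ker_subtype _)
  let π : E →L[ℝ] EuclideanSpace ℝ (Fin k) :=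
    (c : _ →L[ℝ] EuclideanSpace ℝ (Fin k)).comp (LinearMap.toContinuousLinearMap q)
  have hinj : Function.Injective (L.prod π : E →ₗ[ℝ] G × EuclideanSpace ℝ (Fin k)) := by
    rw [← LinearMap.ker_eq_bot, LinearMap.ker_eq_bot']
    intro x hx
    have h1 : L x = 0 := congrArg Prod.fst hx
    have h2 : c (q x) = 0 := congrArg Prod.snd hx
    have h3 : q x = 0 := by simpa using h2
    have h4 := LinearMap.congr_fun hq (⟨x, h1⟩ : LinearMap.ker (L : E →ₗ[ℝ] G))
    have h5 : q x = ⟨x, h1⟩ := h4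
    rw [h3] at h5
    exact (congrArg Subtype.val h5).symm
  have hdim : Module.finrank ℝ E = Module.finrank ℝ (G × EuclideanSpace ℝ (Fin k)) := by
    rw [Module.finrank_prod, finrank_euclideanSpace_fin, hk]
  refine ⟨π, (LinearEquiv.ofInjectiveOfFinrankEq _ hinj hdim).toContinuousLinearEquiv, ?_⟩
  ext x <;> rfl

/-- A regular level set of an analytic map is, locally, the graph of a smooth map over a linear
projection. -/
theorem exists_chart_of_regular {Φ : E → G} {p : E} {k : ℕ} {M W : Set E} (hW : IsOpen W)
    (hpW : p ∈ W) (hM : ∀ x ∈ W, x ∈ M ↔ Φ x = Φ p) (hΦ : ContDiffAt ℝ ω Φ p) {L : E →L[ℝ] G}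
    (hΦ' : HasFDerivAt Φ L p) (hL : Function.Surjective L)
    (hk : Module.finrank ℝ E = Module.finrank ℝ G + k) :
    ∃ (U : Set E) (V : Set (EuclideanSpace ℝ (Fin k))) (φ : EuclideanSpace ℝ (Fin k) → E)
      (π : E →L[ℝ] EuclideanSpace ℝ (Fin k)),
      IsOpen U ∧ p ∈ U ∧ IsOpen V ∧ ContDiffOn ℝ ∞ φ V ∧ MapsTo φ V (M ∩ U) ∧ MapsTo π U V ∧
      InvOn π φ V (M ∩ U) ∧
      ∃ φ' : EuclideanSpace ℝ (Fin k) →L[ℝ] E, HasFDerivAt φ φ' (π p) ∧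
        ∀ v, L v = 0 → φ' (π v) = v := by
  obtain ⟨π, e, he⟩ := exists_prod_equiv_of_surjective L hL hk
  let Ψ : E → G × EuclideanSpace ℝ (Fin k) := fun x => (Φ x, π x)
  have hΨ : ContDiffAt ℝ ω Ψ p := hΦ.prodMk π.contDiff.contDiffAt
  have hΨ' : HasFDerivAt Ψ (e : E →L[ℝ] G × EuclideanSpace ℝ (Fin k)) p := by
    rw [he]; exact hΦ'.prodMk π.hasFDerivAt
  have hω : (ω : WithTop ℕ∞) ≠ 0 := by simp
  have hst := hΨ.hasStrictFDerivAt' hΨ' hω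
  let s := hΨ.localInverse hΨ' hω
  have hsp : s (Ψ p) = p := hΨ.localInverse_apply_image hΨ' hω
  have hs : ContDiffAt ℝ ω s (Ψ p) := hΨ.to_localInverse hΨ' hω
  -- This is where analyticity is used: `C^∞` at a point provides a neighbourhood for each finite
  -- order only, whereas `C^ω` at a point persists on one neighbourhood.
  have h1 : ∀ᶠ y in 𝓝 (Ψ p), ContDiffAt ℝ ω s y := hs.eventually (by simp)
  have h2 : ∀ᶠ y in 𝓝 (Ψ p), Ψ (s y) = y := hst.eventually_right_inverse
  have h3 : ∀ᶠ x in 𝓝 p, s (Ψ x) = x := hst.eventually_left_inverse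
  obtain ⟨O, hO, hOo, hpO⟩ := eventually_nhds_iff.1 (h1.and h2)
  obtain ⟨U₀, hU₀, hU₀o, hpU₀⟩ := eventually_nhds_iff.1 (h3.and (hW.mem_nhds hpW))
  have hsc : ContinuousOn s O := fun y hy => (hO y hy).1.continuousAt.continuousWithinAt
  have hO₁ : IsOpen (O ∩ s ⁻¹' U₀) := hsc.isOpen_inter_preimage hOo hU₀o
  let j : EuclideanSpace ℝ (Fin k) → G × EuclideanSpace ℝ (Fin k) := fun z => (Φ p, z)
  have hj : ContDiff ℝ ∞ j := contDiff_const.prodMk contDiff_id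
  have hV : IsOpen (j ⁻¹' (O ∩ s ⁻¹' U₀)) := hO₁.preimage hj.continuous
  have hφπ : ∀ z ∈ j ⁻¹' (O ∩ s ⁻¹' U₀), Φ (s (j z)) = Φ p ∧ π (s (j z)) = z := fun z hz =>
    ⟨congrArg Prod.fst (hO _ hz.1).2, congrArg Prod.snd (hO _ hz.1).2⟩
  refine ⟨U₀ ∩ π ⁻¹' (j ⁻¹' (O ∩ s ⁻¹' U₀)), j ⁻¹' (O ∩ s ⁻¹' U₀), s ∘ j, π,
    hU₀o.inter (hV.preimage π.continuous), ⟨hpU₀, hpO, ?_⟩, hV, ?_, ?_, fun x hx => hx.2,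
    ⟨fun z hz => (hφπ z hz).2, ?_⟩, ?_⟩
  · change s (Ψ p) ∈ U₀
    rwa [hsp]
  · exact fun z hz => (((hO _ hz.1).1.of_le le_top).comp z hj.contDiffAt).contDiffWithinAt
  · refine fun z hz => ⟨(hM _ (hU₀ _ hz.2).2).2 (hφπ z hz).1, hz.2, ?_⟩
    rw [mem_preimage, Function.comp_apply, (hφπ z hz).2]
    exact hz
  · rintro x ⟨hxM, hxU, -⟩
    have : j (π x) = Ψ x := by
      change (Φ p, π x) = (Φ x, π x)
      rw [(hM x (hU₀ x hxU).2).1 hxM]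
    rw [Function.comp_apply, this]
    exact (hU₀ x hxU).1
  · have hs' : HasFDerivAt s (e.symm : G × EuclideanSpace ℝ (Fin k) →L[ℝ] E) (j (π p)) :=
      hst.to_localInverse.hasFDerivAt
    refine ⟨_, hs'.comp (π p) (hasFDerivAt_prodMk_right (Φ p) (π p)), fun v hv => ?_⟩
    have hev : e v = (0, π v) := by
      have := congrArg (fun T : E →L[ℝ] G × EuclideanSpace ℝ (Fin k) => T v) he
      simpa [hv] using this
    simp [← hev]

/-- The tangent space lies in the kernel because `Φ` is constant on `M` near `p`, so `0` is also a
derivative of `Φ` within `M`. Conversely the chart satisfies `φ'(πv) = v` on the kernel and carries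
tangent cones into that of `M`. The retraction is `φ ∘ π`. -/
theorem regular_level {Φ : E → G} {p : E} {k : ℕ} {M W : Set E} (hW : IsOpen W)
    (hpW : p ∈ W) (hM : ∀ x ∈ W, x ∈ M ↔ Φ x = Φ p) (hΦ : ContDiffAt ℝ ω Φ p) {L : E →L[ℝ] G}
    (hΦ' : HasFDerivAt Φ L p) (hL : Function.Surjective L)
    (hk : Module.finrank ℝ E = Module.finrank ℝ G + k) :
    IsSubmanifoldAt k M p ∧ HasLocalRetraction M p ∧
      tangentSpace M p = LinearMap.ker (L : E →ₗ[ℝ] G) := by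
  obtain ⟨U, V, φ, π, hU, hpU, hV, hφ, hφM, hπ, hinv, φ', hφ', hφπ⟩ :=
    exists_chart_of_regular hW hpW hM hΦ hΦ' hL hk
  have hpM : p ∈ M := (hM p hpW).2 rfl
  refine ⟨⟨U, V, hU, hpU, hV, φ, π, hφ, π.contDiff.contDiffOn, hφM, fun x hx => hπ hx.2, hinv⟩,
    ⟨U, φ ∘ π, hU, hpU, hφ.comp π.contDiff.contDiffOn hπ, fun x hx => (hφM (hπ hx)).1,
      fun x hx => hinv.2 hx⟩, le_antisymm ?_ ?_⟩
  · intro u hu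
    have hc : HasFDerivWithinAt Φ (0 : E →L[ℝ] G) (M ∩ W) p :=
      (hasFDerivWithinAt_const (Φ p) p _).congr (fun x hx => (hM x hx.2).1 hx.1) rfl
    have hc' : HasFDerivWithinAt Φ (0 : E →L[ℝ] G) M p :=
      (hasFDerivWithinAt_inter (hW.mem_nhds hpW)).1 hc
    exact hΦ'.hasFDerivWithinAt.eq_of_mem_tangentSpace hc' hu
  · intro v hv
    have hcone := (hφ'.hasFDerivWithinAt (s := V)).mapsTo_tangent_cone
    rw [tangentConeAt_of_mem_nhds (hV.mem_nhds (hπ hpU))] at hcone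
    have hφp : φ (π p) = p := hinv.2 ⟨hpM, hpU⟩
    rw [hφp] at hcone
    have hv' := hcone (mem_univ (π v))
    rw [hφπ v hv] at hv'
    exact Submodule.subset_span
      (tangentConeAt_mono (image_subset_iff.2 fun z hz => (hφM hz).1) hv')

end RegularLevelSets

/-! ### `Sp(2)` as a regular level set, and its tangent spaces -/

section SymplecticGroup

theorem mem_sp2_iff {ξ : QuatMat} : ξ ∈ sp2 ↔ ξᴴ = -ξ := by
  constructor
  · rintro ⟨h0, h1, h⟩
    ext i j <;> fin_cases i <;> fin_cases j <;> simp [Matrix.conjTranspose_apply, h0, h1, h]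
  · intro h
    have h00 := congrArg (fun A : QuatMat => (A 0 0).re) h
    have h11 := congrArg (fun A : QuatMat => (A 1 1).re) h
    have h10 := congrArg (fun A : QuatMat => A 1 0) h
    simp only [Matrix.conjTranspose_apply, Matrix.neg_apply, Quaternion.re_star,
      Quaternion.re_neg] at h00 h11 h10
    exact ⟨by linarith, by linarith, by rw [h10, neg_neg]⟩

theorem conjTranspose_mul_self_of_mem_Sp2 {p : QuatMat} (hp : p ∈ Sp2) : pᴴ * p = 1 :=
  mul_eq_one_comm.1 hp

theorem mul_cancel_of_mem_Sp2 {p : QuatMat} (hp : p ∈ Sp2) (u : QuatMat) : p * (pᴴ * u) = u := by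
  rw [← mul_assoc, show p * pᴴ = 1 from hp, one_mul]

theorem mul_cancel_of_mem_Sp2' {p : QuatMat} (hp : p ∈ Sp2) (u : QuatMat) : pᴴ * (p * u) = u := by
  rw [← mul_assoc, conjTranspose_mul_self_of_mem_Sp2 hp, one_mul]

/-- Conjugate transposition as a continuous linear map. -/
noncomputable def conjT : QuatMat →L[ℝ] QuatMat :=
  LinearMap.toContinuousLinearMap
    { toFun := fun Q => Qᴴ
      map_add' := Matrix.conjTranspose_add
      map_smul' := fun c Q => by
        ext i j <;> simp [Matrix.conjTranspose_apply] }

@[simp] theorem conjT_apply (Q : QuatMat) : conjT Q = Qᴴ := rfl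

/-- The independent entries of a Hermitian matrix. -/
noncomputable def hermCoord : QuatMat →L[ℝ] ℝ × ℝ × ℍ[ℝ] :=
  LinearMap.toContinuousLinearMap
    { toFun := fun Q => ((Q 0 0).re, (Q 1 1).re, Q 0 1)
      map_add' := fun _ _ => rfl
      map_smul' := fun _ _ => rfl }

@[simp] theorem hermCoord_apply (Q : QuatMat) : hermCoord Q = ((Q 0 0).re, (Q 1 1).re, Q 0 1) := rfl

theorem eq_of_hermCoord_eq {A B : QuatMat} (hA : Aᴴ = A) (hB : Bᴴ = B)
    (h : hermCoord A = hermCoord B) : A = B := by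
  have hAB : (A - B)ᴴ = A - B := by rw [Matrix.conjTranspose_sub, hA, hB]
  have hc : hermCoord (A - B) = 0 := by rw [map_sub, h, sub_self]
  rw [← sub_eq_zero]
  generalize A - B = C at hAB hc
  simp only [hermCoord_apply, Prod.mk_eq_zero] at hc
  obtain ⟨h0, h1, h01⟩ := hc
  have e : ∀ i j, star (C j i) = C i j := fun i j => by
    rw [← Matrix.conjTranspose_apply, hAB]
  have hd : ∀ i, (C i i).re = 0 → C i i = 0 := fun i hi => by
    have := Quaternion.ext_iff.1 (e i i)
    simp only [Quaternion.re_star, Quaternion.imI_star, Quaternion.imJ_star,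
      Quaternion.imK_star] at this
    ext <;> simp only [Quaternion.re_zero, Quaternion.imI_zero, Quaternion.imJ_zero,
      Quaternion.imK_zero] <;> linarith
  ext1 i j
  fin_cases i <;> fin_cases j
  · exact hd 0 h0
  · exact h01
  · change C 1 0 = 0
    rw [← e, h01, star_zero]
  · exact hd 1 h1

theorem exists_hermitian_of_hermCoord (c : ℝ × ℝ × ℍ[ℝ]) : ∃ H : QuatMat, Hᴴ = H ∧
    hermCoord H = c := by
  obtain ⟨r, s, w⟩ := c
  refine ⟨!![(r : ℍ[ℝ]), w; star w, (s : ℍ[ℝ])], ?_, by simp⟩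
  ext1 i j
  fin_cases i <;> fin_cases j <;> simp [Matrix.conjTranspose_apply]

/-- The derivative of `Q ↦ Q Q*`. -/
noncomputable def gramDeriv (p : QuatMat) : QuatMat →L[ℝ] QuatMat :=
  LinearMap.toContinuousLinearMap
    { toFun := fun u => p * uᴴ + u * pᴴ
      map_add' := fun u v => by
        rw [Matrix.conjTranspose_add, mul_add, add_mul]; abel
      map_smul' := fun c u => by
        have : (c • u)ᴴ = c • uᴴ := conjT.map_smul c u
        rw [this]; simp }

@[simp] theorem gramDeriv_apply (p u : QuatMat) : gramDeriv p u = p * uᴴ + u * pᴴ := rfl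

theorem hasFDerivAt_gram (p : QuatMat) :
    HasFDerivAt (fun Q : QuatMat => Q * Qᴴ) (gramDeriv p) p := by
  have h := (hasFDerivAt_id (𝕜 := ℝ) p).mul' conjT.hasFDerivAt
  exact h.congr_fderiv (by ext1 u; rfl)

theorem contDiff_gram {n : WithTop ℕ∞} : ContDiff ℝ n (fun Q : QuatMat => Q * Qᴴ) :=
  contDiff_id.mul conjT.contDiff

/-- `QQ*` is always Hermitian, so `QQ* = 1` is overdetermined as a matrix equation. Keeping only the
`1 + 1 + 4 = 6` independent real coordinates makes the differential surjective and yields dimension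
`16 - 6 = 10`. -/
theorem mem_Sp2_iff_hermCoord {p : QuatMat} (hp : p ∈ Sp2) (Q : QuatMat) :
    Q ∈ Sp2 ↔ hermCoord (Q * Qᴴ) = hermCoord (p * pᴴ) := by
  have hherm : ∀ A : QuatMat, (A * Aᴴ)ᴴ = A * Aᴴ := fun A => by
    rw [Matrix.conjTranspose_mul, Matrix.conjTranspose_conjTranspose]
  constructor
  · intro hQ
    rw [show Q * Qᴴ = 1 from hQ, show p * pᴴ = 1 from hp]
  · intro h
    exact (eq_of_hermCoord_eq (hherm Q) (hherm p) h).trans hp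

/-- Conjugation by the unitary `p` turns `p u* + u p*` into `u* p + p* u`, whose vanishing says that
`p* u` is skew-Hermitian. -/
theorem gramDeriv_eq_zero_iff {p : QuatMat} (hp : p ∈ Sp2) (u : QuatMat) :
    hermCoord (gramDeriv p u) = 0 ↔ pᴴ * u ∈ sp2 := by
  rw [mem_sp2_iff, Matrix.conjTranspose_mul, Matrix.conjTranspose_conjTranspose]
  have e : hermCoord (gramDeriv p u) = 0 ↔ p * uᴴ + u * pᴴ = 0 := by
    constructor
    · intro h
      refine eq_of_hermCoord_eq ?_ Matrix.conjTranspose_zero (h.trans (map_zero _).symm)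
      rw [Matrix.conjTranspose_add, Matrix.conjTranspose_mul,
        Matrix.conjTranspose_mul, Matrix.conjTranspose_conjTranspose,
        Matrix.conjTranspose_conjTranspose, add_comm]
    · intro h
      rw [gramDeriv_apply, h, map_zero]
  rw [e, ← add_eq_zero_iff_eq_neg]
  have hp' := conjTranspose_mul_self_of_mem_Sp2 hp
  constructor
  · intro h
    calc uᴴ * p + pᴴ * u = pᴴ * (p * uᴴ + u * pᴴ) * p := by
          rw [mul_add, mul_cancel_of_mem_Sp2' hp, add_mul, mul_assoc, mul_assoc, hp', mul_one]
      _ = 0 := by rw [h]; simp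
  · intro h
    have hp'' : p * pᴴ = 1 := hp
    calc p * uᴴ + u * pᴴ = p * (uᴴ * p + pᴴ * u) * pᴴ := by
          rw [mul_add, mul_cancel_of_mem_Sp2 hp, add_mul, mul_assoc, mul_assoc, hp'', mul_one]
      _ = 0 := by rw [h]; simp

theorem exists_gramDeriv_eq {p : QuatMat} (hp : p ∈ Sp2) (c : ℝ × ℝ × ℍ[ℝ]) :
    ∃ u, hermCoord (gramDeriv p u) = c := by
  obtain ⟨H, hH, hc⟩ := exists_hermitian_of_hermCoord c
  -- For Hermitian `H` and `u = Hp`, both terms `p u*` and `u p*` equal `H`; hence the factor one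
  -- half.
  refine ⟨((1 : ℝ) / 2) • (H * p), ?_⟩
  have : gramDeriv p (H * p) = (2 : ℝ) • H := by
    have hp'' : p * pᴴ = 1 := hp
    rw [gramDeriv_apply, Matrix.conjTranspose_mul, hH, ← mul_assoc, hp'', mul_assoc, hp'', two_smul,
      one_mul, mul_one]
  rw [map_smul, this, smul_smul]
  norm_num
  simpa using hc

theorem finrank_quatMat : Module.finrank ℝ QuatMat = 16 := by
  rw [Module.finrank_matrix, Quaternion.finrank_eq_four]; simp

theorem Sp2_regular {p : QuatMat} (hp : p ∈ Sp2) :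
    IsSubmanifoldAt 10 Sp2 p ∧ HasLocalRetraction Sp2 p ∧
      tangentSpace Sp2 p =
        LinearMap.ker (hermCoord.comp (gramDeriv p) : QuatMat →ₗ[ℝ] ℝ × ℝ × ℍ[ℝ]) :=
  regular_level (W := univ) (Φ := fun Q => hermCoord (Q * Qᴴ)) isOpen_univ (mem_univ p)
    (fun Q _ => mem_Sp2_iff_hermCoord hp Q)
    (hermCoord.contDiff.comp contDiff_gram).contDiffAt
    (hermCoord.hasFDerivAt.comp p (hasFDerivAt_gram p)) (exists_gramDeriv_eq hp)
    (by rw [finrank_quatMat]; simp [Quaternion.finrank_eq_four])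

theorem mem_tangentSpace_Sp2 {p u : QuatMat} (hp : p ∈ Sp2) :
    u ∈ tangentSpace Sp2 p ↔ pᴴ * u ∈ sp2 := by
  rw [(Sp2_regular hp).2.2]
  exact gramDeriv_eq_zero_iff hp u

theorem one_mem_Sp2 : (1 : QuatMat) ∈ Sp2 := by
  simp [Sp2]

theorem tangentSpace_Sp2_one : (tangentSpace Sp2 1 : Set QuatMat) = sp2 := by
  ext u
  rw [SetLike.mem_coe, mem_tangentSpace_Sp2 one_mem_Sp2, Matrix.conjTranspose_one, one_mul]

theorem mul_mem_tangentSpace_Sp2 {p ξ : QuatMat} (hp : p ∈ Sp2) (hξ : ξ ∈ sp2) :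
    p * ξ ∈ tangentSpace Sp2 p := by
  rwa [mem_tangentSpace_Sp2 hp, mul_cancel_of_mem_Sp2' hp]

end SymplecticGroup

/-! ### Uniqueness of the Levi-Civita connection -/

section LeviCivitaUniqueness

variable {E : Type*} [NormedAddCommGroup E] [NormedSpace ℝ E]

theorem IsSmoothField.mono {N U V : Set E} {X : E → E} (hX : IsSmoothField N V X) (hUV : U ⊆ V) :
    IsSmoothField N U X :=
  ⟨fun p hp => hX.tangent p ⟨hp.1, hUV hp.2⟩, hX.smooth.mono fun _ hp => ⟨hp.1, hUV hp.2⟩⟩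

/-- The Levi-Civita connection is unique, provided that tangent vectors extend to smooth fields. -/
theorem IsLeviCivita.apply_eq {n : ℕ} {N : Set E} {g : E → LinearMap.BilinForm ℝ E}
    (hg : IsRiemannianSubmanifold n N g) {D D' : ConnectionOperator N} (hD : IsLeviCivita N g D)
    (hD' : IsLeviCivita N g D') {p : E} (hp : p ∈ N)
    (hext : ∀ u ∈ tangentSpace N p, ∃ X : E → E, IsSmoothField N univ X ∧ X p = u)
    {U : Set E} (hU : IsOpen U) (hpU : p ∈ U) {Y : E → E} (hY : IsSmoothField N U Y)
    (u : tangentSpace N p) : D Y p u = D' Y p u := by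
  obtain ⟨X, hX, hXu⟩ := hext u u.2
  replace hX := hX.mono (subset_univ U)
  have hpNU : p ∈ N ∩ U := ⟨hp, hpU⟩
  -- The difference tensor of the two connections. It is symmetric because the torsions agree, and
  -- `g(T(A, B), C)` is skew in `B, C` by metric compatibility; alternating the two symmetries
  -- around the three slots forces it to vanish.
  let T : ∀ (A B : E → E), IsSmoothField N U A → tangentSpace N p := fun A B hA =>
    D B p ⟨A p, hA.tangent p hpNU⟩ - D' B p ⟨A p, hA.tangent p hpNU⟩
  have hTsymm : ∀ (A B) (hA : IsSmoothField N U A) (hB : IsSmoothField N U B),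
      T A B hA = T B A hB := by
    intro A B hA hB
    have h := hD.torsion_free U A B hU hA hB p hpNU
    have h' := hD'.torsion_free U A B hU hA hB p hpNU
    rw [← h'] at h
    apply Subtype.ext
    rw [sub_eq_sub_iff_add_eq_add] at h
    simp only [T, Submodule.coe_sub]
    rw [sub_eq_sub_iff_add_eq_add, h, add_comm]
  have hTskew : ∀ (A B C) (hA : IsSmoothField N U A), IsSmoothField N U B → IsSmoothField N U C →
      g p (T A B hA) (C p) = -g p (T A C hA) (B p) := by
    intro A B C hA hB hC
    have h := hD.metric U B C hU hB hC p hpNU ⟨A p, hA.tangent p hpNU⟩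
    have h' := hD'.metric U B C hU hB hC p hpNU ⟨A p, hA.tangent p hpNU⟩
    have hs := hg.symm p hp _ (T A C hA).2 _ (hB.tangent p hpNU)
    rw [h] at h'
    simp only [T, Submodule.coe_sub, map_sub, LinearMap.sub_apply] at hs ⊢
    linarith
  have hzero : ∀ C, IsSmoothField N U C → g p (T X Y hX) (C p) = 0 := by
    intro C hC
    have h1 := hTskew X Y C hX hY hC
    have h2 := hTskew C X Y hC hX hY
    have h3 := hTskew Y C X hY hC hX
    rw [hTsymm X C hX hC, h2, hTsymm C Y hC hY, h3, hTsymm Y X hY hX] at h1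
    linarith
  -- Testing against a field with value `T(X, Y)` at `p` gives `g(T, T) = 0`, so positivity applies.
  obtain ⟨Z, hZ, hZp⟩ := hext _ (T X Y hX).2
  have h0 := hzero Z (hZ.mono (subset_univ U))
  rw [hZp] at h0
  have hT : (T X Y hX : E) = 0 := by
    by_contra hne
    exact (hg.pos p hp _ (T X Y hX).2 hne).ne' h0
  have hu : (⟨X p, hX.tangent p hpNU⟩ : tangentSpace N p) = u := Subtype.ext hXu
  have := Subtype.ext (a2 := (0 : tangentSpace N p)) hT
  simp only [T, hu] at this
  exact sub_eq_zero.1 this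

end LeviCivitaUniqueness

/-! ### The connection on left invariant fields -/

section LeftInvariantConnection

/-- The skew-Hermitian part of a matrix. -/
noncomputable def skewPart : QuatMat →L[ℝ] QuatMat :=
  ((1 : ℝ) / 2) • (ContinuousLinearMap.id ℝ QuatMat - conjT)

/-- `𝔰𝔭(2)` as a real subspace. -/
noncomputable def sp2Submodule : Submodule ℝ QuatMat :=
  LinearMap.ker (ContinuousLinearMap.id ℝ QuatMat + conjT : QuatMat →ₗ[ℝ] QuatMat)

theorem mem_sp2Submodule {ξ : QuatMat} : ξ ∈ sp2Submodule ↔ ξ ∈ sp2 := by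
  rw [mem_sp2_iff, sp2Submodule, LinearMap.mem_ker, eq_neg_iff_add_eq_zero, add_comm]
  rfl

theorem skewPart_mem (ξ : QuatMat) : skewPart ξ ∈ sp2Submodule := by
  refine sp2Submodule.smul_mem _ ?_
  rw [mem_sp2Submodule, mem_sp2_iff]
  simp

theorem skewPart_eq_self {ξ : QuatMat} (hξ : ξ ∈ sp2Submodule) : skewPart ξ = ξ := by
  rw [mem_sp2Submodule, mem_sp2_iff] at hξ
  simp only [skewPart, _root_.smul_apply, _root_.sub_apply,
    ContinuousLinearMap.id_apply, conjT_apply, hξ]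
  module

theorem commutator_mem {ξ η : QuatMat} (hξ : ξ ∈ sp2Submodule) (hη : η ∈ sp2Submodule) :
    ξ * η - η * ξ ∈ sp2Submodule := by
  rw [mem_sp2Submodule, mem_sp2_iff] at *
  rw [Matrix.conjTranspose_sub, Matrix.conjTranspose_mul, Matrix.conjTranspose_mul, hξ, hη]
  noncomm_ring

/-- The diagonal part of a matrix. -/
noncomputable def diagPart : QuatMat →L[ℝ] QuatMat :=
  LinearMap.toContinuousLinearMap
    { toFun := fun Q => !![Q 0 0, 0; 0, Q 1 1]
      map_add' := fun A B => by ext1 i j; fin_cases i <;> fin_cases j <;> simp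
      map_smul' := fun c A => by ext1 i j; fin_cases i <;> fin_cases j <;> simp }

@[simp] theorem diagPart_apply (Q : QuatMat) : diagPart Q = !![Q 0 0, 0; 0, Q 1 1] := rfl

theorem diagPart_mem {ξ : QuatMat} (hξ : ξ ∈ sp2Submodule) : diagPart ξ ∈ sp2Submodule := by
  rw [mem_sp2Submodule] at *
  exact ⟨hξ.1, hξ.2.1, by simp⟩

/-- The covariant derivative of the left invariant field `η` in the left invariant direction `ξ`,
in the left trivialization. -/
noncomputable def invConn (ξ η : QuatMat) : QuatMat :=
  ((1 : ℝ) / 2) • (diagPart ξ * diagPart η - diagPart η * diagPart ξ)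
    + ((1 : ℝ) / 2) • ((ξ - diagPart ξ) * (η - diagPart η) - (η - diagPart η) * (ξ - diagPart ξ))
    + ((ξ - diagPart ξ) * diagPart η - diagPart η * (ξ - diagPart ξ))

theorem invConn_mem {ξ η : QuatMat} (hξ : ξ ∈ sp2Submodule) (hη : η ∈ sp2Submodule) :
    invConn ξ η ∈ sp2Submodule := by
  have hξ' := diagPart_mem hξ
  have hη' := diagPart_mem hη
  have hξ'' := sp2Submodule.sub_mem hξ hξ'
  have hη'' := sp2Submodule.sub_mem hη hη'
  exact add_mem (add_mem (sp2Submodule.smul_mem _ (commutator_mem hξ' hη'))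
    (sp2Submodule.smul_mem _ (commutator_mem hξ'' hη''))) (commutator_mem hξ'' hη')

/-- Torsion freeness on left invariant fields. The mixed coefficients `1` and `0` (off-diagonal
direction against diagonal field, and the reverse) add up to the full bracket, just as the two
halves do in the unmixed terms. -/
theorem invConn_sub_invConn (ξ η : QuatMat) : invConn ξ η - invConn η ξ = ξ * η - η * ξ := by
  unfold invConn
  obtain ⟨a, ha⟩ : ∃ a, diagPart ξ = a := ⟨_, rfl⟩
  obtain ⟨b, hb⟩ : ∃ b, diagPart η = b := ⟨_, rfl⟩
  rw [ha, hb]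
  simp only [mul_sub, sub_mul]
  module

theorem invConn_add_right (ξ η ζ : QuatMat) :
    invConn ξ (η + ζ) = invConn ξ η + invConn ξ ζ := by
  simp only [invConn, map_add, mul_add, add_mul, mul_sub, sub_mul]
  module

theorem invConn_smul_right (c : ℝ) (ξ η : QuatMat) : invConn ξ (c • η) = c • invConn ξ η := by
  simp only [invConn, map_smul, mul_sub, sub_mul, smul_mul_assoc, mul_smul_comm]
  module

theorem invConn_add_left (ξ η ζ : QuatMat) :
    invConn (ξ + η) ζ = invConn ξ ζ + invConn η ζ := by
  simp only [invConn, map_add, mul_add, add_mul, mul_sub, sub_mul]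
  module

theorem invConn_smul_left (c : ℝ) (ξ η : QuatMat) : invConn (c • ξ) η = c • invConn ξ η := by
  simp only [invConn, map_smul, mul_sub, sub_mul, smul_mul_assoc, mul_smul_comm]
  module

/-- The inner product at the identity. -/
noncomputable def sp2Form : QuatMat →L[ℝ] QuatMat →L[ℝ] ℝ :=
  LinearMap.toContinuousBilinearMap (sp2Metric 1)

theorem sp2Form_apply (u v : QuatMat) : sp2Form u v =
    inner ℝ (u 0 0) (v 0 0) + inner ℝ (u 0 1) (v 0 1) + inner ℝ (u 1 1) (v 1 1) := by
  change sp2Metric 1 u v = _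
  simp only [sp2Metric, LinearMap.mk₂_apply, Matrix.conjTranspose_one, one_mul]

theorem sp2Metric_apply (p u v : QuatMat) : sp2Metric p u v = sp2Form (pᴴ * u) (pᴴ * v) := by
  rw [sp2Form_apply]; rfl

theorem sp2Form_comm (u v : QuatMat) : sp2Form u v = sp2Form v u := by
  simp only [sp2Form_apply, real_inner_comm]

/-- Metric compatibility on left invariant fields. The form `|x|² + 2|y|² + |z|²` is bi-invariant
and would give half the bracket; the present metric halves it on the off-diagonal part. Koszul's
formula then changes only the mixed coefficients, from `1/2, 1/2` to `1, 0`. -/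
theorem sp2Form_invConn {ξ η ζ : QuatMat} (hξ : ξ ∈ sp2) (hη : η ∈ sp2) (hζ : ζ ∈ sp2) :
    sp2Form (invConn ξ η) ζ + sp2Form η (invConn ξ ζ) = 0 := by
  obtain ⟨a0, a1, a2⟩ := hξ
  obtain ⟨b0, b1, b2⟩ := hη
  obtain ⟨c0, c1, c2⟩ := hζ
  simp only [sp2Form_apply, invConn, diagPart_apply, Matrix.add_apply, Matrix.sub_apply,
    Matrix.smul_apply, Matrix.mul_apply, Fin.sum_univ_two, Quaternion.inner_def]
  simp [a0, a1, a2, b0, b1, b2, c0, c1, c2]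
  ring

end LeftInvariantConnection

/-! ### The Levi-Civita connection of `Sp(2)` -/

section LeviCivitaOfSp2

/-- The left trivialization of a vector field. -/
noncomputable def frameCoord (Y : QuatMat → QuatMat) : QuatMat → QuatMat := fun q => qᴴ * Y q

/-- The operator `u ↦ ∇_u Y`, before restriction to the tangent space. -/
noncomputable def sp2ConnectionAux (Y : QuatMat → QuatMat) (p : QuatMat) :
    QuatMat →ₗ[ℝ] QuatMat where
  toFun u :=
    p * skewPart (fderivWithin ℝ (frameCoord Y) Sp2 p u + invConn (pᴴ * u) (frameCoord Y p))
  map_add' u v := by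
    simp only [map_add, mul_add, invConn_add_left]; abel
  map_smul' c u := by
    simp only [map_smul, mul_smul_comm, invConn_smul_left, map_add, mul_add, smul_add,
      RingHom.id_apply]

open Classical in
/-- The Levi-Civita connection of `Sp(2)`, in explicit form. -/
noncomputable def sp2Connection : ConnectionOperator Sp2 := fun Y p =>
  if hp : p ∈ Sp2 then
    ((sp2ConnectionAux Y p).comp (tangentSpace Sp2 p).subtype).codRestrict (tangentSpace Sp2 p)
      fun _ => mul_mem_tangentSpace_Sp2 hp (mem_sp2Submodule.1 (skewPart_mem _))
  else 0

theorem sp2Connection_apply (Y : QuatMat → QuatMat) {p : QuatMat} (hp : p ∈ Sp2)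
    (u : tangentSpace Sp2 p) : (sp2Connection Y p u : QuatMat) =
      p * skewPart (fderivWithin ℝ (frameCoord Y) Sp2 p u
        + invConn (pᴴ * u) (frameCoord Y p)) := by
  rw [sp2Connection, dif_pos hp]; rfl

theorem frameCoord_mem {U : Set QuatMat} {Y : QuatMat → QuatMat} (hY : IsSmoothField Sp2 U Y)
    {p : QuatMat} (hp : p ∈ Sp2 ∩ U) : frameCoord Y p ∈ sp2Submodule :=
  mem_sp2Submodule.2 ((mem_tangentSpace_Sp2 hp.1).1 (hY.tangent p hp))

theorem contDiffOn_frameCoord {U : Set QuatMat} {Y : QuatMat → QuatMat}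
    (hY : IsSmoothField Sp2 U Y) : ContDiffOn ℝ ∞ (frameCoord Y) (Sp2 ∩ U) :=
  conjT.contDiff.contDiffOn.mul hY.smooth

theorem ContDiffOn.hasFDerivWithinAt_of_isOpen {E F : Type*} [NormedAddCommGroup E]
    [NormedSpace ℝ E] [NormedAddCommGroup F] [NormedSpace ℝ F] {f : E → F} {N U : Set E}
    (hf : ContDiffOn ℝ ∞ f (N ∩ U)) (hU : IsOpen U) {p : E} (hp : p ∈ N ∩ U) :
    HasFDerivWithinAt f (fderivWithin ℝ f N p) N p := by
  have h := hf.differentiableOn (by simp) p hp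
  exact ((differentiableWithinAt_inter (hU.mem_nhds hp.2)).1 h).hasFDerivWithinAt

theorem hasFDerivWithinAt_frameCoord {U : Set QuatMat} (hU : IsOpen U) {Y : QuatMat → QuatMat}
    (hY : IsSmoothField Sp2 U Y) {p : QuatMat} (hp : p ∈ Sp2 ∩ U) :
    HasFDerivWithinAt (frameCoord Y) (fderivWithin ℝ (frameCoord Y) Sp2 p) Sp2 p :=
  ContDiffOn.hasFDerivWithinAt_of_isOpen (contDiffOn_frameCoord hY) hU hp

theorem fderivWithin_field {U : Set QuatMat} (hU : IsOpen U) {Y : QuatMat → QuatMat}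
    (hY : IsSmoothField Sp2 U Y) {p u : QuatMat} (hp : p ∈ Sp2 ∩ U) (hu : u ∈ tangentSpace Sp2 p) :
    fderivWithin ℝ Y Sp2 p u
      = p * fderivWithin ℝ (frameCoord Y) Sp2 p u + u * frameCoord Y p := by
  have h := (hasFDerivWithinAt_id (𝕜 := ℝ) p Sp2).mul' (hasFDerivWithinAt_frameCoord hU hY hp)
  have h' := h.congr (f₁ := Y) (fun q hq => (mul_cancel_of_mem_Sp2 hq (Y q)).symm)
    (mul_cancel_of_mem_Sp2 hp.1 (Y p)).symm
  exact fderivWithin_apply_of_mem_tangentSpace h' hu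

/-- On `Sp2 ∩ U` the coordinate map is fixed by the linear projection `skewPart`, so its tangential
derivatives are too. -/
theorem fderivWithin_frameCoord_mem {U : Set QuatMat} (hU : IsOpen U) {Y : QuatMat → QuatMat}
    (hY : IsSmoothField Sp2 U Y) {p u : QuatMat} (hp : p ∈ Sp2 ∩ U) (hu : u ∈ tangentSpace Sp2 p) :
    fderivWithin ℝ (frameCoord Y) Sp2 p u ∈ sp2Submodule := by
  have h := hasFDerivWithinAt_frameCoord hU hY hp
  have h' := (skewPart.hasFDerivAt.comp_hasFDerivWithinAt p h).mono (inter_subset_left (t := U))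
  have h'' := h'.congr (f₁ := frameCoord Y)
    (fun q hq => (skewPart_eq_self (frameCoord_mem hY hq)).symm)
    (skewPart_eq_self (frameCoord_mem hY hp)).symm
  have e : skewPart (fderivWithin ℝ (frameCoord Y) Sp2 p u)
      = fderivWithin ℝ (frameCoord Y) Sp2 p u :=
    ((hasFDerivWithinAt_inter (hU.mem_nhds hp.2)).1 h'').eq_of_mem_tangentSpace h hu
  rw [← e]
  exact skewPart_mem _

/-- The projection in the definition only serves to make the operator tangent for arbitrary `Y`; on
smooth fields it is the identity. -/
theorem sp2Connection_eq {U : Set QuatMat} (hU : IsOpen U) {Y : QuatMat → QuatMat}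
    (hY : IsSmoothField Sp2 U Y) {p : QuatMat} (hp : p ∈ Sp2 ∩ U) (u : tangentSpace Sp2 p) :
    (sp2Connection Y p u : QuatMat) =
      p * (fderivWithin ℝ (frameCoord Y) Sp2 p u + invConn (pᴴ * u) (frameCoord Y p)) := by
  rw [sp2Connection_apply Y hp.1, skewPart_eq_self]
  exact add_mem (fderivWithin_frameCoord_mem hU hY hp u.2)
    (invConn_mem (mem_sp2Submodule.2 ((mem_tangentSpace_Sp2 hp.1).1 u.2)) (frameCoord_mem hY hp))

theorem contDiffOn_invConn {S : Set QuatMat} {f h : QuatMat → QuatMat} (hf : ContDiffOn ℝ ∞ f S)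
    (hh : ContDiffOn ℝ ∞ h S) : ContDiffOn ℝ ∞ (fun p => invConn (f p) (h p)) S := by
  have df := diagPart.contDiff.comp_contDiffOn hf
  have dh := diagPart.contDiff.comp_contDiffOn hh
  have of := hf.sub df
  have oh := hh.sub dh
  exact ((((df.mul dh).sub (dh.mul df)).const_smul _).add
    (((of.mul oh).sub (oh.mul of)).const_smul _)).add ((of.mul dh).sub (dh.mul of))

theorem isRiemannianSubmanifold_Sp2 : IsRiemannianSubmanifold 10 Sp2 sp2Metric where
  submanifold p hp := (Sp2_regular hp).1
  symm p _ u _ v _ := by rw [sp2Metric_apply, sp2Metric_apply, sp2Form_comm]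
  pos p hp u hu hne := by
    rw [sp2Metric_apply, sp2Form_apply]
    obtain ⟨-, -, h10⟩ := (mem_tangentSpace_Sp2 hp).1 hu
    have hne' : pᴴ * u ≠ 0 := fun h => hne (by rw [← mul_cancel_of_mem_Sp2 hp u, h, mul_zero])
    generalize pᴴ * u = ξ at h10 hne'
    simp only [real_inner_self_eq_norm_sq]
    by_contra hle
    have h0 : ‖ξ 0 0‖ = 0 := by nlinarith [sq_nonneg ‖ξ 0 0‖, sq_nonneg ‖ξ 0 1‖, sq_nonneg ‖ξ 1 1‖]
    have h1 : ‖ξ 0 1‖ = 0 := by nlinarith [sq_nonneg ‖ξ 0 0‖, sq_nonneg ‖ξ 0 1‖, sq_nonneg ‖ξ 1 1‖]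
    have h2 : ‖ξ 1 1‖ = 0 := by nlinarith [sq_nonneg ‖ξ 0 0‖, sq_nonneg ‖ξ 0 1‖, sq_nonneg ‖ξ 1 1‖]
    rw [norm_eq_zero] at h0 h1 h2
    refine hne' ?_
    ext1 i j
    fin_cases i <;> fin_cases j
    · exact h0
    · exact h1
    · change ξ 1 0 = 0
      rw [h10, h1, star_zero, neg_zero]
    · exact h2
  smooth U X Y _ hX hY := by
    simp only [sp2Metric_apply]
    exact (sp2Form.contDiff.comp_contDiffOn (contDiffOn_frameCoord hX)).clm_apply
      (contDiffOn_frameCoord hY)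

/-- With `Y = qη` the operator is `dη + invConn`. The Leibniz rule comes from `d`. The torsion
identity follows from `dY(u) = p dη(u) + uη` and `invConn_sub_invConn`, and metric compatibility
from `sp2Form_invConn`, the form being constant in these coordinates. -/
theorem isLeviCivita_sp2Connection : IsLeviCivita Sp2 sp2Metric sp2Connection where
  smooth U X Y Z hU hX hY hZ := by
    have h1 := contDiffOn_fderivWithin_apply_field (fun p hp => (Sp2_regular hp).2.1) hU
      (contDiffOn_frameCoord hY) hX
    have h2 := h1.add (contDiffOn_invConn (contDiffOn_frameCoord hX) (contDiffOn_frameCoord hY))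
    exact (contDiffOn_id.mul h2).congr fun p hp => by
      rw [hZ p hp, sp2Connection_eq hU hY hp]; rfl
  add U Y Z hU hY hZ p hp u := by
    have hYZ : IsSmoothField Sp2 U (Y + Z) :=
      ⟨fun q hq => add_mem (hY.tangent q hq) (hZ.tangent q hq), hY.smooth.add hZ.smooth⟩
    have hc : frameCoord (Y + Z) = frameCoord Y + frameCoord Z := by
      ext1 q; exact mul_add _ _ _
    have e : fderivWithin ℝ (frameCoord Y + frameCoord Z) Sp2 p u
        = fderivWithin ℝ (frameCoord Y) Sp2 p u + fderivWithin ℝ (frameCoord Z) Sp2 p u :=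
      fderivWithin_apply_of_mem_tangentSpace
        ((hasFDerivWithinAt_frameCoord hU hY hp).add (hasFDerivWithinAt_frameCoord hU hZ hp)) u.2
    apply Subtype.ext
    rw [Submodule.coe_add, sp2Connection_eq hU hYZ hp, sp2Connection_eq hU hY hp,
      sp2Connection_eq hU hZ hp, hc, e, Pi.add_apply, invConn_add_right]
    simp only [mul_add]
    abel
  leibniz U f Y hU hf hY p hp u := by
    have hfY : IsSmoothField Sp2 U (fun q => f q • Y q) :=
      ⟨fun q hq => Submodule.smul_mem _ _ (hY.tangent q hq), hf.smul hY.smooth⟩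
    have hc : frameCoord (fun q => f q • Y q) = fun q => f q • frameCoord Y q := by
      ext1 q; exact mul_smul_comm _ _ _
    have hf' := ContDiffOn.hasFDerivWithinAt_of_isOpen hf hU hp
    have e : fderivWithin ℝ (fun q => f q • frameCoord Y q) Sp2 p u
        = f p • fderivWithin ℝ (frameCoord Y) Sp2 p u
          + fderivWithin ℝ f Sp2 p u • frameCoord Y p :=
      fderivWithin_apply_of_mem_tangentSpace
        (hf'.smul (hasFDerivWithinAt_frameCoord hU hY hp)) u.2
    rw [sp2Connection_eq hU hfY hp, sp2Connection_eq hU hY hp, hc, e, invConn_smul_right]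
    simp only [mul_add, mul_smul_comm, smul_add]
    rw [frameCoord, mul_cancel_of_mem_Sp2 hp.1]
    exact add_right_comm _ _ _
  torsion_free U X Y hU hX hY p hp := by
    rw [sp2Connection_eq hU hY hp, sp2Connection_eq hU hX hp]
    change _ = fderivWithin ℝ Y Sp2 p (X p) - fderivWithin ℝ X Sp2 p (Y p)
    rw [fderivWithin_field hU hY hp (hX.tangent p hp),
      fderivWithin_field hU hX hp (hY.tangent p hp)]
    have h := invConn_sub_invConn (frameCoord X p) (frameCoord Y p)
    change p * (_ + invConn (frameCoord X p) _) - p * (_ + invConn (frameCoord Y p) _) = _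
    have hX' : X p = p * frameCoord X p := (mul_cancel_of_mem_Sp2 hp.1 (X p)).symm
    have hY' : Y p = p * frameCoord Y p := (mul_cancel_of_mem_Sp2 hp.1 (Y p)).symm
    have h' : invConn (frameCoord X p) (frameCoord Y p) = invConn (frameCoord Y p) (frameCoord X p)
        + (frameCoord X p * frameCoord Y p - frameCoord Y p * frameCoord X p) := by
      rw [← h]; abel
    have e1 : X p * frameCoord Y p = p * (frameCoord X p * frameCoord Y p) := by
      rw [← mul_assoc, ← hX']
    have e2 : Y p * frameCoord X p = p * (frameCoord Y p * frameCoord X p) := by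
      rw [← mul_assoc, ← hY']
    rw [h', e1, e2]
    simp only [mul_add, mul_sub]
    abel
  metric U Y Z hU hY hZ p hp u := by
    have hYd := hasFDerivWithinAt_frameCoord hU hY hp
    have hZd := hasFDerivWithinAt_frameCoord hU hZ hp
    have hξ := (mem_tangentSpace_Sp2 hp.1).1 u.2
    have hη := mem_sp2Submodule.1 (frameCoord_mem hY hp)
    have hζ := mem_sp2Submodule.1 (frameCoord_mem hZ hp)
    have hd := sp2Form.hasFDerivWithinAt_of_bilinear hYd hZd
    have hg : (fun q => sp2Metric q (Y q) (Z q))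
        = fun q => sp2Form (frameCoord Y q) (frameCoord Z q) := by
      ext1 q; exact sp2Metric_apply _ _ _
    have e : fderivWithin ℝ (fun q => sp2Form (frameCoord Y q) (frameCoord Z q)) Sp2 p u
        = sp2Form (frameCoord Y p) (fderivWithin ℝ (frameCoord Z) Sp2 p u)
          + sp2Form (fderivWithin ℝ (frameCoord Y) Sp2 p u) (frameCoord Z p) :=
      fderivWithin_apply_of_mem_tangentSpace hd u.2
    rw [hg]
    refine e.trans ?_
    rw [sp2Connection_eq hU hY hp,
      sp2Connection_eq hU hZ hp, sp2Metric_apply, sp2Metric_apply, mul_cancel_of_mem_Sp2' hp.1,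
      mul_cancel_of_mem_Sp2' hp.1]
    have h := sp2Form_invConn hξ hη hζ
    change sp2Form (frameCoord Y p) (fderivWithin ℝ (frameCoord Z) Sp2 p u)
      + sp2Form (fderivWithin ℝ (frameCoord Y) Sp2 p u) (frameCoord Z p)
      = sp2Form _ (frameCoord Z p) + sp2Form (frameCoord Y p) _
    simp only [map_add, _root_.add_apply]
    linarith

theorem isLeviCivita_leviCivita_Sp2 : IsLeviCivita Sp2 sp2Metric (leviCivita Sp2 sp2Metric) :=
  Classical.epsilon_spec ⟨sp2Connection, isLeviCivita_sp2Connection⟩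

/-- The chosen connection is only pinned down on smooth fields, so uniqueness is invoked there, with
left invariant fields as the extensions of tangent vectors. -/
theorem leviCivita_Sp2_apply {U : Set QuatMat} (hU : IsOpen U) {Y : QuatMat → QuatMat}
    (hY : IsSmoothField Sp2 U Y) {p : QuatMat} (hp : p ∈ Sp2 ∩ U) (u : tangentSpace Sp2 p) :
    (leviCivita Sp2 sp2Metric Y p u : QuatMat) =
      p * (fderivWithin ℝ (frameCoord Y) Sp2 p u + invConn (pᴴ * u) (frameCoord Y p)) := by
  rw [← sp2Connection_eq hU hY hp, isLeviCivita_leviCivita_Sp2.apply_eq isRiemannianSubmanifold_Sp2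
    isLeviCivita_sp2Connection hp.1 ?_ hU hp.2 hY u]
  intro v hv
  refine ⟨fun q => q * (pᴴ * v), ⟨fun q hq => ?_, ?_⟩, mul_cancel_of_mem_Sp2 hp.1 v⟩
  · exact mul_mem_tangentSpace_Sp2 hq.1 ((mem_tangentSpace_Sp2 hp.1).1 hv)
  · exact (contDiff_id.mul contDiff_const).contDiffOn

end LeviCivitaOfSp2

/-! ### Gradient, Hessian and Laplacian of `Re a` -/

section GradientAndHessian

/-- The gradient of `Q ↦ Re a`, in the left trivialization. -/
noncomputable def gradCoord : QuatMat →L[ℝ] QuatMat :=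
  LinearMap.toContinuousLinearMap
    { toFun := fun Q => !![-(Q 0 0).im, -Q 0 1; star (Q 0 1), 0]
      map_add' := fun A B => by
        ext1 i j; fin_cases i <;> fin_cases j <;> simp <;> abel
      map_smul' := fun c A => by
        ext1 i j; fin_cases i <;> fin_cases j <;> simp }

theorem gradCoord_apply (Q : QuatMat) :
    gradCoord Q = !![-(Q 0 0).im, -Q 0 1; star (Q 0 1), 0] := rfl

/-- The function `Q ↦ Re a` as a continuous linear functional. -/
noncomputable def reAL : QuatMat →L[ℝ] ℝ :=
  LinearMap.toContinuousLinearMap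
    { toFun := reA
      map_add' := fun _ _ => rfl
      map_smul' := fun _ _ => rfl }

theorem reAL_apply (Q : QuatMat) : reAL Q = reA Q := rfl

theorem contDiff_reA {n : WithTop ℕ∞} : ContDiff ℝ n reA := reAL.contDiff

theorem hasFDerivAt_reA (p : QuatMat) : HasFDerivAt reA reAL p := reAL.hasFDerivAt

theorem gradCoord_mem (Q : QuatMat) : gradCoord Q ∈ sp2 := by
  simp [gradCoord_apply, sp2]

theorem sp2Form_gradCoord (Q : QuatMat) {ξ : QuatMat} (hξ : ξ ∈ sp2) :
    sp2Form (gradCoord Q) ξ = reA (Q * ξ) := by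
  obtain ⟨h0, h1, h2⟩ := hξ
  simp only [sp2Form_apply, gradCoord_apply, reA, Matrix.mul_apply, Fin.sum_univ_two,
    Quaternion.inner_def]
  simp [h0, h2]
  ring

theorem first_row_of_mem_Sp2 {Q : QuatMat} (hQ : Q ∈ Sp2) :
    ‖Q 0 0‖ ^ 2 + ‖Q 0 1‖ ^ 2 = 1 := by
  have h := congrArg (fun A : QuatMat => (A 0 0).re) (show Q * Qᴴ = 1 from hQ)
  simp only [Matrix.mul_apply, Fin.sum_univ_two, Matrix.conjTranspose_apply, Matrix.one_apply_eq,
    Quaternion.re_add, Quaternion.re_one] at h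
  rw [← h, ← real_inner_self_eq_norm_sq, ← real_inner_self_eq_norm_sq, Quaternion.inner_def,
    Quaternion.inner_def]

theorem norm_sq_eq (q : ℍ[ℝ]) : ‖q‖ ^ 2 = q.re ^ 2 + q.imI ^ 2 + q.imJ ^ 2 + q.imK ^ 2 := by
  rw [← real_inner_self_eq_norm_sq, Quaternion.inner_def]
  simp
  ring

theorem sp2Form_gradCoord_self {Q : QuatMat} (hQ : Q ∈ Sp2) :
    sp2Form (gradCoord Q) (gradCoord Q) = 1 - reA Q ^ 2 := by
  have h := first_row_of_mem_Sp2 hQ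
  rw [norm_sq_eq, norm_sq_eq] at h
  rw [sp2Form_gradCoord Q (gradCoord_mem Q), ← h]
  simp only [gradCoord_apply, reA, Matrix.mul_apply, Fin.sum_univ_two]
  simp
  ring

theorem fderivWithin_reA {Q u : QuatMat} (hu : u ∈ tangentSpace Sp2 Q) :
    fderivWithin ℝ reA Sp2 Q u = reA u :=
  fderivWithin_apply_of_mem_tangentSpace (hasFDerivAt_reA Q).hasFDerivWithinAt hu

theorem riemGradient_reA {Q : QuatMat} (hQ : Q ∈ Sp2) :
    riemGradient Sp2 sp2Metric reA Q = Q * gradCoord Q := by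
  have hw : Q * gradCoord Q ∈ tangentSpace Sp2 Q ∧ ∀ v ∈ tangentSpace Sp2 Q,
      sp2Metric Q (Q * gradCoord Q) v = fderivWithin ℝ reA Sp2 Q v := by
    refine ⟨mul_mem_tangentSpace_Sp2 hQ (gradCoord_mem Q), fun v hv => ?_⟩
    rw [fderivWithin_reA hv, sp2Metric_apply, mul_cancel_of_mem_Sp2' hQ,
      sp2Form_gradCoord Q ((mem_tangentSpace_Sp2 hQ).1 hv), mul_cancel_of_mem_Sp2 hQ]
  obtain ⟨h1, h2⟩ := Classical.epsilon_spec (p := fun w : QuatMat => w ∈ tangentSpace Sp2 Q ∧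
    ∀ v ∈ tangentSpace Sp2 Q, sp2Metric Q w v = fderivWithin ℝ reA Sp2 Q v) ⟨_, hw⟩
  change riemGradient Sp2 sp2Metric reA Q ∈ _ at h1
  change ∀ v ∈ _, sp2Metric Q (riemGradient Sp2 sp2Metric reA Q) v = _ at h2
  by_contra hne
  -- The chosen vector and the candidate represent the same functional, so their difference is
  -- tangent and orthogonal to itself.
  have hmem := Submodule.sub_mem _ h1 hw.1
  have hpos := isRiemannianSubmanifold_Sp2.pos Q hQ _ hmem (sub_ne_zero.2 hne)
  refine hpos.ne' ?_
  have hsymm := isRiemannianSubmanifold_Sp2.symm Q hQ _ hmem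
  rw [map_sub, hsymm _ h1, hsymm _ hw.1, h2 _ hmem, hw.2 _ hmem, sub_self]

theorem gradNormSq_reA {Q : QuatMat} (hQ : Q ∈ Sp2) :
    gradNormSq Sp2 sp2Metric reA Q = 1 - reA Q ^ 2 := by
  rw [gradNormSq, riemGradient_reA hQ, sp2Metric_apply, mul_cancel_of_mem_Sp2' hQ,
    sp2Form_gradCoord_self hQ]

theorem isSmoothField_riemGradient_reA :
    IsSmoothField Sp2 univ (riemGradient Sp2 sp2Metric reA) where
  tangent p hp := by
    rw [riemGradient_reA hp.1]
    exact mul_mem_tangentSpace_Sp2 hp.1 (gradCoord_mem p)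
  smooth := (contDiff_id.mul gradCoord.contDiff).contDiffOn.congr fun p hp => riemGradient_reA hp.1

theorem sp2_ext {ξ η : QuatMat} (hξ : ξ ∈ sp2) (hη : η ∈ sp2) (h0 : ξ 0 0 = η 0 0)
    (h1 : ξ 0 1 = η 0 1) (h2 : ξ 1 1 = η 1 1) : ξ = η := by
  have h3 : ξ 1 0 = η 1 0 := by rw [hξ.2.2, hη.2.2, h1]
  ext1 i j
  fin_cases i <;> fin_cases j
  exacts [h0, h1, h3, h2]

/-- The Hessian of `Q ↦ Re a`, in the left trivialization. -/
theorem hessian_eq (p : QuatMat) {ξ : QuatMat} (hξ : ξ ∈ sp2) :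
    gradCoord (p * ξ) + invConn ξ (gradCoord p) =
      !![-reA p • ξ 0 0, -reA p • ξ 0 1 - p 0 1 * ξ 1 1;
        -star (-reA p • ξ 0 1 - p 0 1 * ξ 1 1), -(star (p 0 1) * ξ 0 1).im] := by
  have hl : gradCoord (p * ξ) + invConn ξ (gradCoord p) ∈ sp2 :=
    mem_sp2Submodule.1 (add_mem (mem_sp2Submodule.2 (gradCoord_mem _))
      (invConn_mem (mem_sp2Submodule.2 hξ) (mem_sp2Submodule.2 (gradCoord_mem p))))
  obtain ⟨h0, h1, h2⟩ := hξ
  refine sp2_ext hl ⟨by simp [h0], by simp, rfl⟩ ?_ ?_ ?_ <;>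
  simp only [gradCoord_apply, reA, invConn, diagPart_apply, Matrix.add_apply, Matrix.sub_apply,
    Matrix.smul_apply, Matrix.mul_apply, Fin.sum_univ_two, h2, Matrix.of_apply,
    Matrix.cons_val'] <;>
  ext <;> simp [h0, h1] <;> ring

/-- In the left trivialization the gradient is the restriction of a linear map, which is therefore
its own derivative. -/
theorem leviCivita_riemGradient_reA {p : QuatMat} (hp : p ∈ Sp2) (u : tangentSpace Sp2 p) :
    (leviCivita Sp2 sp2Metric (riemGradient Sp2 sp2Metric reA) p u : QuatMat) =
      p * (gradCoord u + invConn (pᴴ * u) (gradCoord p)) := by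
  have hf : ∀ q ∈ Sp2, frameCoord (riemGradient Sp2 sp2Metric reA) q = gradCoord q := fun q hq => by
    rw [frameCoord, riemGradient_reA hq, mul_cancel_of_mem_Sp2' hq]
  have e : fderivWithin ℝ (frameCoord (riemGradient Sp2 sp2Metric reA)) Sp2 p u = gradCoord u :=
    fderivWithin_apply_of_mem_tangentSpace
      (gradCoord.hasFDerivAt.hasFDerivWithinAt.congr hf (hf p hp)) u.2
  rw [leviCivita_Sp2_apply isOpen_univ isSmoothField_riemGradient_reA ⟨hp, mem_univ p⟩, e, hf p hp]

/-- The quaternion with given real coordinates. -/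
def quat (r x y z : ℝ) : ℍ[ℝ] := ⟨r, x, y, z⟩

@[simp] theorem re_quat (r x y z : ℝ) : (quat r x y z).re = r := rfl
@[simp] theorem imI_quat (r x y z : ℝ) : (quat r x y z).imI = x := rfl
@[simp] theorem imJ_quat (r x y z : ℝ) : (quat r x y z).imJ = y := rfl
@[simp] theorem imK_quat (r x y z : ℝ) : (quat r x y z).imK = z := rfl

/-- The element of `𝔰𝔭(2)` with given real coordinates. -/
def sp2OfCoord (c : Fin 10 → ℝ) : QuatMat :=
  !![quat 0 (c 0) (c 1) (c 2), quat (c 3) (c 4) (c 5) (c 6);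
    -star (quat (c 3) (c 4) (c 5) (c 6)), quat 0 (c 7) (c 8) (c 9)]

theorem sp2OfCoord_mem (c : Fin 10 → ℝ) : sp2OfCoord c ∈ sp2 := ⟨rfl, rfl, rfl⟩

/-- The real coordinates of an element of `𝔰𝔭(2)`. -/
def coordOfMat (ξ : QuatMat) : Fin 10 → ℝ :=
  ![(ξ 0 0).imI, (ξ 0 0).imJ, (ξ 0 0).imK, (ξ 0 1).re, (ξ 0 1).imI, (ξ 0 1).imJ, (ξ 0 1).imK,
    (ξ 1 1).imI, (ξ 1 1).imJ, (ξ 1 1).imK]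

/-- The left trivialization of the tangent spaces of `Sp(2)`. -/
noncomputable def tangentEquiv {p : QuatMat} (hp : p ∈ Sp2) :
    (Fin 10 → ℝ) ≃ₗ[ℝ] tangentSpace Sp2 p where
  toFun c := ⟨p * sp2OfCoord c, mul_mem_tangentSpace_Sp2 hp (sp2OfCoord_mem c)⟩
  map_add' c d := by
    apply Subtype.ext
    simp only [Submodule.coe_add]
    rw [← mul_add]
    congr 1
    ext i j <;> fin_cases i <;> fin_cases j <;> simp [sp2OfCoord] <;> abel
  map_smul' r c := by
    apply Subtype.ext
    simp only [Submodule.coe_smul, RingHom.id_apply]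
    rw [← mul_smul_comm]
    congr 1
    ext i j <;> fin_cases i <;> fin_cases j <;> simp [sp2OfCoord]
  invFun u := coordOfMat (pᴴ * u)
  left_inv c := by
    simp only [mul_cancel_of_mem_Sp2' hp]
    ext i; fin_cases i <;> rfl
  right_inv u := by
    apply Subtype.ext
    have h := (mem_tangentSpace_Sp2 hp).1 u.2
    simp only
    conv_rhs => rw [← mul_cancel_of_mem_Sp2 hp (u : QuatMat)]
    congr 1
    generalize pᴴ * (u : QuatMat) = ξ at h
    have h0 := h.1
    have h1 := h.2.1
    apply sp2_ext (sp2OfCoord_mem _) h <;> ext <;> simp [sp2OfCoord, coordOfMat, h0, h1]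

theorem finrank_tangentSpace_Sp2 {p : QuatMat} (hp : p ∈ Sp2) :
    Module.finrank ℝ (tangentSpace Sp2 p) = 10 := by
  rw [← (tangentEquiv hp).finrank_eq]; simp

/-- The terms coupling `y` and `z` are off-diagonal and drop out of the trace. What remains is `-t`
on the three coordinates of `x` and the four of `y`, and `0` on those of `z`. -/
theorem laplacian_reA {p : QuatMat} (hp : p ∈ Sp2) :
    laplacian Sp2 sp2Metric reA p = -7 * reA p := by
  rw [laplacian, ← LinearMap.trace_conj' _ (tangentEquiv hp).symm,
    LinearMap.trace_eq_matrix_trace ℝ (Pi.basisFun ℝ (Fin 10)), Matrix.trace]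
  have key : ∀ c i, ((tangentEquiv hp).symm.conj
      (leviCivita Sp2 sp2Metric (riemGradient Sp2 sp2Metric reA) p)) c i
      = coordOfMat (!![-reA p • sp2OfCoord c 0 0,
          -reA p • sp2OfCoord c 0 1 - p 0 1 * sp2OfCoord c 1 1;
        -star (-reA p • sp2OfCoord c 0 1 - p 0 1 * sp2OfCoord c 1 1),
          -(star (p 0 1) * sp2OfCoord c 0 1).im]) i := by
    intro c i
    rw [← hessian_eq p (sp2OfCoord_mem c)]
    change coordOfMat (pᴴ * (leviCivita Sp2 sp2Metric (riemGradient Sp2 sp2Metric reA) p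
      (tangentEquiv hp c) : QuatMat)) i = _
    rw [leviCivita_riemGradient_reA hp, mul_cancel_of_mem_Sp2' hp]
    change coordOfMat (gradCoord (p * sp2OfCoord c) + invConn (pᴴ * (p * sp2OfCoord c)) _) i = _
    rw [mul_cancel_of_mem_Sp2' hp]
  simp only [Matrix.diag_apply, LinearMap.toMatrix_apply, Pi.basisFun_apply, Pi.basisFun_repr, key]
  simp [Fin.sum_univ_succ, coordOfMat, sp2OfCoord, Pi.single_apply]
  ring

end GradientAndHessian

/-! ### Eigenspaces of the rescaled shape operator -/

section PrincipalCurvatures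

/-- The imaginary quaternion with given coordinates. -/
def imOf : (Fin 3 → ℝ) →ₗ[ℝ] ℍ[ℝ] where
  toFun c := quat 0 (c 0) (c 1) (c 2)
  map_add' c d := by ext <;> simp
  map_smul' r c := by ext <;> simp

theorem imOf_apply (c : Fin 3 → ℝ) : imOf c = quat 0 (c 0) (c 1) (c 2) := rfl

@[simp] theorem re_imOf (c : Fin 3 → ℝ) : (imOf c).re = 0 := rfl

theorem imOf_injective : Function.Injective imOf := by
  intro c d h
  ext i
  fin_cases i
  · exact congrArg QuaternionAlgebra.imI h
  · exact congrArg QuaternionAlgebra.imJ h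
  · exact congrArg QuaternionAlgebra.imK h

theorem exists_imOf_eq {q : ℍ[ℝ]} (hq : q.re = 0) : ∃ c, imOf c = q :=
  ⟨![q.imI, q.imJ, q.imK], by ext <;> simp [imOf_apply, hq]⟩

/-- The real part as a linear functional. -/
def reLin : ℍ[ℝ] →ₗ[ℝ] ℝ := QuaternionAlgebra.reₗ _ _ _

/-- The eigenspace of the shape operator of the level hypersurfaces for the eigenvalue
`m / |∇F|`, in the left trivialization; `(a, b)` is the first row of the point. -/
def shapeEigenspace (a b : ℍ[ℝ]) (m : ℝ) : Submodule ℝ (ℍ[ℝ] × ℍ[ℝ] × ℍ[ℝ]) where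
  carrier := {v | v.1.re = 0 ∧ v.2.2.re = 0 ∧ (a * v.1 - b * star v.2.1).re = 0 ∧
    a.re • v.1 = m • v.1 ∧ a.re • v.2.1 + b * v.2.2 = m • v.2.1 ∧
    (star b * v.2.1).im = m • v.2.2}
  zero_mem' := by simp
  add_mem' := by
    rintro ⟨x, y, z⟩ ⟨x', y', z'⟩ ⟨h1, h2, h3, h4, h5, h6⟩ ⟨k1, k2, k3, k4, k5, k6⟩
    refine ⟨by simpa using congrArg₂ (· + ·) h1 k1, by simpa using congrArg₂ (· + ·) h2 k2, ?_,
      ?_, ?_, ?_⟩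
    · have := congrArg₂ (· + ·) h3 k3
      simp only [add_zero, ← Quaternion.re_add] at this
      have e : a * (x + x') - b * star (y + y') = a * x - b * star y + (a * x' - b * star y') := by
        rw [star_add, mul_add, mul_add]; abel
      rw [← e] at this
      exact this
    · simp only [Prod.mk_add_mk, smul_add] at *
      rw [h4, k4]
    · simp only [Prod.mk_add_mk, smul_add, mul_add] at *
      rw [← h5, ← k5]
      abel
    · simp only [Prod.mk_add_mk, smul_add, mul_add, Quaternion.im_add] at *
      rw [h6, k6]
  smul_mem' := by
    rintro c ⟨x, y, z⟩ ⟨h1, h2, h3, h4, h5, h6⟩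
    simp only [mem_ofPred_eq, Prod.smul_mk] at *
    refine ⟨by simp [h1], by simp [h2], ?_, ?_, ?_, ?_⟩
    · have : a * c • x - b * star (c • y) = c • (a * x - b * star y) := by
        rw [Quaternion.star_smul, mul_smul_comm, mul_smul_comm, smul_sub]
      rw [this, Quaternion.re_smul, h3, smul_zero]
    · rw [smul_comm, h4, smul_comm]
    · rw [smul_comm, mul_smul_comm, ← smul_add, h5, smul_comm]
    · rw [mul_smul_comm, Quaternion.im_smul, h6, smul_comm]

theorem mem_shapeEigenspace {a b x y z : ℍ[ℝ]} {m : ℝ} : (x, y, z) ∈ shapeEigenspace a b m ↔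
    x.re = 0 ∧ z.re = 0 ∧ (a * x - b * star y).re = 0 ∧
    a.re • x = m • x ∧ a.re • y + b * z = m • y ∧ (star b * y).im = m • z := Iff.rfl

theorem finrank_eq_of_range_eq {V W : Type*} [AddCommGroup V] [Module ℝ V] [AddCommGroup W]
    [Module ℝ W] {f : V →ₗ[ℝ] W} (hf : Function.Injective f) {S : Submodule ℝ W}
    (hfS : ∀ v, f v ∈ S) (hS : ∀ w ∈ S, ∃ v, f v = w) :
    Module.finrank ℝ S = Module.finrank ℝ V := by
  have : S = LinearMap.range f := le_antisymm (fun w hw => hS w hw)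
    (by rintro _ ⟨v, rfl⟩; exact hfS v)
  rw [this, LinearMap.finrank_range_of_inj hf]

theorem star_mul_self_mul (b q : ℍ[ℝ]) : star b * (b * q) = (‖b‖ ^ 2) • q := by
  rw [← mul_assoc, Quaternion.star_mul_self, Quaternion.normSq_eq_norm_mul_self, ← pow_two,
    Quaternion.coe_mul_eq_smul]

theorem eq_zero_of_re_smul_eq {a x : ℍ[ℝ]} {m : ℝ} (hm : m ≠ a.re) (h : a.re • x = m • x) :
    x = 0 := by
  rw [← sub_eq_zero, ← sub_smul, smul_eq_zero, sub_eq_zero] at h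
  exact h.resolve_left hm.symm

/-- Multiplying `bz = (m - t)y` by `b̄` and taking imaginary parts gives `|b|² z = m(m - t) z`, so
`z`, then `y`, vanish; `x` vanishes since `m ≠ t`. -/
theorem shapeEigenspace_eq_bot {a b : ℍ[ℝ]} {m : ℝ} (hm : m ≠ a.re)
    (h : m * (m - a.re) ≠ ‖b‖ ^ 2) : shapeEigenspace a b m = ⊥ := by
  rw [Submodule.eq_bot_iff]
  rintro ⟨x, y, z⟩ hv
  obtain ⟨-, hz, -, hx, hy, hyz⟩ := mem_shapeEigenspace.1 hv
  have hbz : b * z = (m - a.re) • y := by rw [sub_smul, ← hy]; abel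
  have h1 : (‖b‖ ^ 2) • z = (m - a.re) • (star b * y) := by
    rw [← star_mul_self_mul, hbz, mul_smul_comm]
  have h2 : (‖b‖ ^ 2) • z = (m * (m - a.re)) • z := by
    have := congrArg Quaternion.im h1
    rw [Quaternion.im_smul, Quaternion.im_smul, hyz, smul_smul, mul_comm (m - _)] at this
    rw [← this]
    congr 1
    ext <;> simp [hz]
  have hz0 : z = 0 := by
    rw [← sub_eq_zero, ← sub_smul, smul_eq_zero, sub_eq_zero] at h2
    exact h2.resolve_left h.symm
  have hy0 : y = 0 := by
    rw [hz0, mul_zero, eq_comm, smul_eq_zero, sub_eq_zero] at hbz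
    exact hbz.resolve_left hm
  rw [eq_zero_of_re_smul_eq hm hx, hy0, hz0]
  rfl

/-- The eigenvectors are `(0, bc, (m - t)c)` with `c` imaginary. Tangency to the level set is
automatic, as `b c̄ b̄` is imaginary. -/
theorem finrank_shapeEigenspace_of_root {a b : ℍ[ℝ]} {m : ℝ} (hm : m ≠ a.re)
    (h : m * (m - a.re) = ‖b‖ ^ 2) : Module.finrank ℝ (shapeEigenspace a b m) = 3 := by
  let f : (Fin 3 → ℝ) →ₗ[ℝ] ℍ[ℝ] × ℍ[ℝ] × ℍ[ℝ] :=
    LinearMap.prod 0 (LinearMap.prod ((LinearMap.mulLeft ℝ b).comp imOf) ((m - a.re) • imOf))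
  have hm' : m - a.re ≠ 0 := sub_ne_zero.2 hm
  have hf : ∀ c, f c = (0, b * imOf c, (m - a.re) • imOf c) := fun _ => rfl
  have hinj : Function.Injective f := fun c d hcd => by
    rw [hf, hf, Prod.mk.injEq, Prod.mk.injEq] at hcd
    exact imOf_injective (smul_right_injective _ hm' hcd.2.2)
  rw [finrank_eq_of_range_eq hinj, Module.finrank_fin_fun]
  · intro c
    rw [hf, mem_shapeEigenspace]
    refine ⟨rfl, by simp, ?_, by simp, ?_, ?_⟩
    · rw [star_mul, mul_zero, zero_sub]
      simp [imOf_apply]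
      ring
    · rw [mul_smul_comm, ← add_smul, add_sub_cancel]
    · rw [star_mul_self_mul, smul_smul, h]
      ext <;> simp
  · rintro ⟨x, y, z⟩ hv
    obtain ⟨-, hz, -, hx, hy, -⟩ := mem_shapeEigenspace.1 hv
    obtain ⟨c, hc⟩ := exists_imOf_eq (q := (m - a.re)⁻¹ • z) (by simp [hz])
    have hbz : b * z = (m - a.re) • y := by rw [sub_smul, ← hy]; abel
    refine ⟨c, ?_⟩
    rw [hf, hc, smul_inv_smul₀ hm', mul_smul_comm, hbz, inv_smul_smul₀ hm',
      eq_zero_of_re_smul_eq hm hx]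

/-- Here `bz = 0` forces `z = 0`, and then `Im(b̄ y) = 0` makes `y` a real multiple of `b`. The
tangency condition determines that multiple from the free imaginary `x`. -/
theorem finrank_shapeEigenspace_re {a b : ℍ[ℝ]} (hb : b ≠ 0) :
    Module.finrank ℝ (shapeEigenspace a b a.re) = 3 := by
  have hb' : ‖b‖ ^ 2 ≠ 0 := pow_ne_zero 2 (norm_ne_zero_iff.2 hb)
  let ρ : (Fin 3 → ℝ) →ₗ[ℝ] ℝ :=
    (‖b‖ ^ 2)⁻¹ • ((reLin).comp ((LinearMap.mulLeft ℝ a).comp imOf))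
  let f : (Fin 3 → ℝ) →ₗ[ℝ] ℍ[ℝ] × ℍ[ℝ] × ℍ[ℝ] :=
    LinearMap.prod imOf (LinearMap.prod (ρ.smulRight b) 0)
  have hf : ∀ c, f c = (imOf c, ((‖b‖ ^ 2)⁻¹ * (a * imOf c).re) • b, 0) := fun _ => rfl
  have hinj : Function.Injective f := fun c d hcd => by
    rw [hf, hf, Prod.mk.injEq] at hcd
    exact imOf_injective hcd.1
  have hconstr : ∀ (x : ℍ[ℝ]) (r : ℝ),
      (a * x - b * star (r • b)).re = (a * x).re - r * ‖b‖ ^ 2 := by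
    intro x r
    rw [Quaternion.star_smul, mul_smul_comm, Quaternion.self_mul_star,
      Quaternion.normSq_eq_norm_mul_self, ← pow_two, Quaternion.re_sub, Quaternion.re_smul,
      Quaternion.re_coe, smul_eq_mul]
  rw [finrank_eq_of_range_eq hinj, Module.finrank_fin_fun]
  · intro c
    rw [hf, mem_shapeEigenspace]
    refine ⟨rfl, rfl, ?_, rfl, by simp, ?_⟩
    · rw [hconstr]
      field_simp
      ring
    · rw [mul_smul_comm, Quaternion.star_mul_self]
      ext <;> simp
  · rintro ⟨x, y, z⟩ hv
    obtain ⟨hx, hz, h, -, hy, hyz⟩ := mem_shapeEigenspace.1 hv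
    have hz0 : z = 0 := by
      rw [add_eq_left, mul_eq_zero] at hy
      exact hy.resolve_left hb
    have hby : star b * y = ((star b * y).re : ℍ[ℝ]) := by
      rw [hz0, smul_zero] at hyz
      conv_lhs => rw [← Quaternion.re_add_im (star b * y), hyz, add_zero]
    have hyb : y = ((‖b‖ ^ 2)⁻¹ * (star b * y).re) • b := by
      have h1 : b * (star b * y) = (‖b‖ ^ 2) • y := by
        simpa using star_mul_self_mul (star b) y
      rw [hby, Quaternion.mul_coe_eq_smul] at h1
      rw [mul_smul, h1, inv_smul_smul₀ hb']
    obtain ⟨c, rfl⟩ := exists_imOf_eq hx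
    refine ⟨c, ?_⟩
    rw [hyb, hconstr] at h
    rw [hf, hz0, Prod.mk.injEq, Prod.mk.injEq]
    refine ⟨rfl, ?_, rfl⟩
    rw [hyb]
    congr 1
    generalize (star b * y).re = r at *
    field_simp at h ⊢
    linarith

/-- With `b = 0` the tangency condition restricts `x` to the plane `Re(ax) = 0` and leaves `y` free:
`2 + 4`. The equation `tz = 0` frees `z` as well exactly when `t = 0`, adding `3`. -/
theorem finrank_shapeEigenspace_zero_re {a : ℍ[ℝ]} (ha : a.im ≠ 0) :
    Module.finrank ℝ (shapeEigenspace a 0 a.re) = if a.re = 0 then 9 else 6 := by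
  let ℓ : (Fin 3 → ℝ) →ₗ[ℝ] ℝ := (reLin).comp ((LinearMap.mulLeft ℝ a).comp imOf)
  have hℓ : ∀ c, ℓ c = (a * imOf c).re := fun _ => rfl
  have hℓ0 : ℓ ≠ 0 := by
    intro h0
    obtain ⟨c, hc⟩ := exists_imOf_eq (q := a.im) (by simp)
    have h1 : (a * a.im).re = 0 := by rw [← hc, ← hℓ, h0]; rfl
    have h2 : ‖a.im‖ ^ 2 = 0 := by
      rw [norm_sq_eq]
      simp at h1 ⊢
      linarith
    exact ha (norm_eq_zero.1 (pow_eq_zero_iff two_ne_zero |>.1 h2))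
  have hdim : Module.finrank ℝ (LinearMap.ker ℓ) = 2 := by
    have := Module.Dual.finrank_ker_add_one_of_ne_zero hℓ0
    rw [Module.finrank_fin_fun] at this
    exact Nat.succ_injective this
  split_ifs with ht
  · let f : (LinearMap.ker ℓ × ℍ[ℝ] × (Fin 3 → ℝ)) →ₗ[ℝ] ℍ[ℝ] × ℍ[ℝ] × ℍ[ℝ] :=
      (imOf.comp (LinearMap.ker ℓ).subtype).prodMap (LinearMap.id.prodMap imOf)
    have hinj : Function.Injective f :=
      (imOf_injective.comp Subtype.val_injective).prodMap
        (Function.injective_id.prodMap imOf_injective)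
    rw [finrank_eq_of_range_eq hinj]
    · simp [hdim, Quaternion.finrank_eq_four]
    · rintro ⟨⟨c, hc⟩, y, d⟩
      have hc' : (a * imOf c).re = 0 := hc
      change (imOf c, y, imOf d) ∈ _
      rw [mem_shapeEigenspace, ht]
      refine ⟨rfl, rfl, ?_, by simp, by simp, by simp⟩
      rw [zero_mul, sub_zero, hc']
    · rintro ⟨x, y, z⟩ hv
      obtain ⟨hx, hz, h, -, -, -⟩ := mem_shapeEigenspace.1 hv
      obtain ⟨c, rfl⟩ := exists_imOf_eq hx
      obtain ⟨d, rfl⟩ := exists_imOf_eq hz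
      rw [zero_mul, sub_zero] at h
      exact ⟨(⟨c, h⟩, y, d), rfl⟩
  · let f : (LinearMap.ker ℓ × ℍ[ℝ]) →ₗ[ℝ] ℍ[ℝ] × ℍ[ℝ] × ℍ[ℝ] :=
      (imOf.comp (LinearMap.ker ℓ).subtype).prodMap (LinearMap.prod LinearMap.id 0)
    have hinl : Function.Injective (LinearMap.prod LinearMap.id 0 : ℍ[ℝ] →ₗ[ℝ] ℍ[ℝ] × ℍ[ℝ]) :=
      fun _ _ h => congrArg Prod.fst h
    have hinj : Function.Injective f :=
      (imOf_injective.comp Subtype.val_injective).prodMap hinl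
    rw [finrank_eq_of_range_eq hinj]
    · simp [hdim, Quaternion.finrank_eq_four]
    · rintro ⟨⟨c, hc⟩, y⟩
      have hc' : (a * imOf c).re = 0 := hc
      change (imOf c, y, (0 : ℍ[ℝ])) ∈ _
      rw [mem_shapeEigenspace]
      refine ⟨rfl, rfl, ?_, rfl, by simp, by simp⟩
      rw [zero_mul, sub_zero, hc']
    · rintro ⟨x, y, z⟩ hv
      obtain ⟨hx, -, h, -, -, hz⟩ := mem_shapeEigenspace.1 hv
      obtain ⟨c, rfl⟩ := exists_imOf_eq hx
      have hz0 : z = 0 := by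
        rw [star_zero, zero_mul, Quaternion.im_zero, eq_comm, smul_eq_zero] at hz
        exact hz.resolve_left ht
      rw [zero_mul, sub_zero] at h
      exact ⟨(⟨c, h⟩, y), by rw [hz0]; rfl⟩

/-- The dimensions of the eigenspaces of the shape operator. -/
theorem finrank_shapeEigenspace {a b : ℍ[ℝ]} (hab : ‖a‖ ^ 2 + ‖b‖ ^ 2 = 1) (h1 : -1 < a.re)
    (h2 : a.re < 1) (m : ℝ) : Module.finrank ℝ (shapeEigenspace a b m) =
      (if a.re = m then 3 else 0) + (if (a.re + √(a.re ^ 2 + 4 * ‖b‖ ^ 2)) / 2 = m then 3 else 0)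
        + (if (a.re - √(a.re ^ 2 + 4 * ‖b‖ ^ 2)) / 2 = m then 3 else 0) := by
  have hr0 := Real.sqrt_nonneg (a.re ^ 2 + 4 * ‖b‖ ^ 2)
  have hr := Real.sq_sqrt (show 0 ≤ a.re ^ 2 + 4 * ‖b‖ ^ 2 by positivity)
  generalize √(a.re ^ 2 + 4 * ‖b‖ ^ 2) = r at hr0 hr
  by_cases hm : m = a.re
  · subst hm
    by_cases hb : b = 0
    · subst hb
      -- Otherwise `|a| = 1` would give `Re a = ±1`, a focal value.
      have ha : a.im ≠ 0 := by
        intro h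
        have h3 := Quaternion.ext_iff.1 h
        simp only [Quaternion.imI_im, Quaternion.imJ_im, Quaternion.imK_im, Quaternion.imI_zero,
          Quaternion.imJ_zero, Quaternion.imK_zero] at h3
        rw [norm_sq_eq, h3.2.1, h3.2.2.1, h3.2.2.2, norm_zero] at hab
        nlinarith
      rw [finrank_shapeEigenspace_zero_re ha]
      rw [norm_zero] at hr
      by_cases ht : a.re = 0
      · have : r = 0 := by rw [ht] at hr; exact pow_eq_zero_iff two_ne_zero |>.1 (by linarith)
        simp [ht, this]
      · rcases eq_or_eq_neg_of_sq_eq_sq r a.re (by linarith) with h | h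
        · have h4 : (a.re - a.re) / 2 ≠ a.re := fun h5 => ht (by linarith)
          have h5 : (a.re + a.re) / 2 = a.re := by ring
          rw [h, if_neg ht, if_pos rfl, if_pos h5, if_neg h4]
        · have h4 : (a.re + -a.re) / 2 ≠ a.re := fun h5 => ht (by linarith)
          have h5 : (a.re - -a.re) / 2 = a.re := by ring
          rw [h, if_neg ht, if_pos rfl, if_pos h5, if_neg h4]
    · have hb' : 0 < ‖b‖ ^ 2 := pow_pos (norm_pos_iff.2 hb) 2
      rw [finrank_shapeEigenspace_re hb, if_pos rfl, if_neg, if_neg]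
      · intro h
        have : r = -a.re := by linarith
        rw [this] at hr
        linarith
      · intro h
        have : r = a.re := by linarith
        rw [this] at hr
        linarith
  · rw [if_neg (Ne.symm hm)]
    by_cases hroot : m * (m - a.re) = ‖b‖ ^ 2
    · rw [finrank_shapeEigenspace_of_root hm hroot]
      -- Completing the square in `m(m - t) = |b|²`. A double root `r = 0` would need `t = 0` and `m
      -- = 0 = t`, which is excluded here, so exactly one sign matches.
      have hsq : (2 * m - a.re) ^ 2 = r ^ 2 := by rw [hr, ← hroot]; ring
      have hr' : r ≠ 0 := fun h => by
        rw [h] at hr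
        have ht : a.re = 0 := pow_eq_zero_iff two_ne_zero |>.1 (by nlinarith [sq_nonneg ‖b‖])
        have hm0 : 2 * m - a.re = 0 :=
          pow_eq_zero_iff two_ne_zero |>.1 (by rw [hsq, h, zero_pow two_ne_zero])
        exact hm (by linarith)
      rcases eq_or_eq_neg_of_sq_eq_sq _ _ hsq with h | h
      · rw [if_pos (by linarith), if_neg fun h' => hr' (by linarith)]
      · rw [if_neg fun h' => hr' (by linarith), if_pos (by linarith)]
    · rw [shapeEigenspace_eq_bot hm hroot, finrank_bot, if_neg, if_neg]
      · rintro rfl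
        exact hroot (by linear_combination hr / 4)
      · rintro rfl
        exact hroot (by linear_combination hr / 4)

end PrincipalCurvatures

/-! ### Level hypersurfaces and their principal curvatures -/

section LevelHypersurfaces

theorem levelSet_regular {t : ℝ} (ht : -1 < t) (ht' : t < 1) {Q : QuatMat} (hQ : Q ∈ levelSet t) :
    IsSubmanifoldAt 9 (levelSet t) Q ∧ HasLocalRetraction (levelSet t) Q ∧
      tangentSpace (levelSet t) Q = LinearMap.ker
        ((hermCoord.comp (gramDeriv Q)).prod reAL : QuatMat →ₗ[ℝ] (ℝ × ℝ × ℍ[ℝ]) × ℝ) := by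
  refine regular_level (W := univ) (Φ := fun Q => (hermCoord (Q * Qᴴ), reA Q)) isOpen_univ
    (mem_univ Q) (fun Q' _ => ?_) ((hermCoord.contDiff.comp contDiff_gram).prodMk
      contDiff_reA).contDiffAt ((hermCoord.hasFDerivAt.comp Q (hasFDerivAt_gram Q)).prodMk
      (hasFDerivAt_reA Q)) ?_ (by rw [finrank_quatMat]; simp [Quaternion.finrank_eq_four])
  · rw [Prod.mk.injEq, ← mem_Sp2_iff_hermCoord hQ.1, hQ.2]
    rfl
  · rintro ⟨c, τ⟩
    obtain ⟨u, hu⟩ := exists_gramDeriv_eq hQ.1 c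
    have h0 : hermCoord (gramDeriv Q (Q * gradCoord Q)) = 0 := by
      rw [gramDeriv_eq_zero_iff hQ.1, mul_cancel_of_mem_Sp2' hQ.1]
      exact gradCoord_mem Q
    have h1 : reAL (Q * gradCoord Q) = 1 - t ^ 2 := by
      rw [reAL_apply, ← sp2Form_gradCoord Q (gradCoord_mem Q), sp2Form_gradCoord_self hQ.1, hQ.2]
    have h2 : 1 - t ^ 2 ≠ 0 := by nlinarith
    -- The gradient is tangent to `Sp(2)`, so adding a multiple of it leaves the first component
    -- alone, while `dF(∇F) = 1 - t² ≠ 0` lets it adjust the second.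
    refine ⟨u + ((τ - reA u) / (1 - t ^ 2)) • (Q * gradCoord Q), ?_⟩
    refine Prod.ext ?_ ?_
    · change hermCoord (gramDeriv Q _) = c
      rw [map_add, map_add, map_smul, map_smul, h0, smul_zero, add_zero, hu]
    · change reAL _ = τ
      rw [map_add, map_smul, h1, reAL_apply, smul_eq_mul, div_mul_cancel₀ _ h2]
      ring

theorem mem_tangentSpace_levelSet {t : ℝ} (ht : -1 < t) (ht' : t < 1) {Q u : QuatMat}
    (hQ : Q ∈ levelSet t) : u ∈ tangentSpace (levelSet t) Q ↔
      u ∈ tangentSpace Sp2 Q ∧ reA u = 0 := by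
  rw [(levelSet_regular ht ht' hQ).2.2, (Sp2_regular hQ.1).2.2]
  exact Prod.mk_eq_zero

/-- The factor `1/|∇F|` is a function of `F`, so its derivative vanishes along level directions and
only the Hessian term of the Leibniz rule survives. -/
theorem leviCivita_unitNormal {t : ℝ} (ht : -1 < t) (ht' : t < 1) {Q : QuatMat}
    (hQ : Q ∈ levelSet t) (u : tangentSpace Sp2 Q) (hu : reA u = 0) :
    leviCivita Sp2 sp2Metric (unitNormal Sp2 sp2Metric reA) Q u =
      (√(1 - t ^ 2))⁻¹ • leviCivita Sp2 sp2Metric (riemGradient Sp2 sp2Metric reA) Q u := by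
  -- Away from the focal sets `1 - F²` is positive and the square root is smooth.
  let U : Set QuatMat := reA ⁻¹' Ioo (-1) 1
  have hU : IsOpen U := isOpen_Ioo.preimage (contDiff_reA (n := 0)).continuous
  have hQU : Q ∈ Sp2 ∩ U := ⟨hQ.1, by rw [mem_preimage, hQ.2]; exact ⟨ht, ht'⟩⟩
  let h : ℝ → ℝ := fun s => (√(1 - s ^ 2))⁻¹
  have hh : ∀ s ∈ Ioo (-1 : ℝ) 1, ContDiffAt ℝ ∞ h s := by
    intro s hs
    have hpos : 0 < 1 - s ^ 2 := by nlinarith [hs.1, hs.2]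
    have h1 : ContDiffAt ℝ ∞ (fun s : ℝ => 1 - s ^ 2) s := by fun_prop
    exact (h1.sqrt hpos.ne').inv (Real.sqrt_pos.2 hpos).ne'
  let f : QuatMat → ℝ := fun q => (√(gradNormSq Sp2 sp2Metric reA q))⁻¹
  have hfh : ∀ q ∈ Sp2, f q = (h ∘ reA) q := fun q hq => by
    simp only [f, h, Function.comp_apply, gradNormSq_reA hq]
  have hf : ContDiffOn ℝ ∞ f (Sp2 ∩ U) := by
    have : ContDiffOn ℝ ∞ (h ∘ reA) (Sp2 ∩ U) := fun q hq =>
      ((hh _ hq.2).comp q contDiff_reA.contDiffAt).contDiffWithinAt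
    exact this.congr fun q hq => hfh q hq.1
  have hd : fderivWithin ℝ f Sp2 Q u = 0 := by
    have h1 := ((hh t ⟨ht, ht'⟩).differentiableAt (by simp)).hasFDerivAt
    rw [← hQ.2] at h1
    have h2 := ((h1.comp Q (hasFDerivAt_reA Q)).hasFDerivWithinAt (s := Sp2)).congr hfh
      (hfh Q hQ.1)
    refine (fderivWithin_apply_of_mem_tangentSpace h2 u.2).trans ?_
    change fderiv ℝ h (reA Q) (reA u) = 0
    rw [hu, map_zero]
  have hl := isLeviCivita_leviCivita_Sp2.leibniz U f _ hU hf
    (isSmoothField_riemGradient_reA.mono (subset_univ U)) Q hQU u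
  have hfQ : f Q = (√(1 - t ^ 2))⁻¹ := by rw [hfh Q hQ.1, Function.comp_apply, hQ.2]
  apply Subtype.ext
  refine hl.trans ?_
  have hd' : fderivWithin ℝ f Sp2 Q u • riemGradient Sp2 sp2Metric reA Q = 0 := by
    rw [hd, zero_smul]
  rw [hfQ]
  exact (congrArg _ hd').trans (add_zero _)

/-- The first row and the last entry of a matrix. -/
noncomputable def entries : QuatMat →ₗ[ℝ] ℍ[ℝ] × ℍ[ℝ] × ℍ[ℝ] where
  toFun ξ := (ξ 0 0, ξ 0 1, ξ 1 1)
  map_add' _ _ := rfl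
  map_smul' _ _ := rfl

theorem entries_apply (ξ : QuatMat) : entries ξ = (ξ 0 0, ξ 0 1, ξ 1 1) := rfl

/-- Multiplying the eigenvalue equation by `|∇F| = √(1 - t²)` replaces the shape operator by minus
the Hessian and `μ` by `μ√(1 - t²)`, which reduces the problem to linear algebra on `(x, y, z)`. -/
theorem mem_principalSpace_iff {t : ℝ} (ht : -1 < t) (ht' : t < 1) {Q : QuatMat}
    (hQ : Q ∈ levelSet t) (μ : ℝ) (u : tangentSpace Sp2 Q) :
    u ∈ principalSpace Sp2 sp2Metric (levelSet t) (unitNormal Sp2 sp2Metric reA) Q μ ↔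
      entries (Qᴴ * u) ∈ shapeEigenspace (Q 0 0) (Q 0 1) (μ * √(1 - t ^ 2)) := by
  have hξ := (mem_tangentSpace_Sp2 hQ.1).1 u.2
  have hs : 0 < √(1 - t ^ 2) := Real.sqrt_pos.2 (by nlinarith)
  have htQ : (Q 0 0).re = t := hQ.2
  have hreA : reA u = (Q 0 0 * (Qᴴ * (u : QuatMat)) 0 0
      - Q 0 1 * star ((Qᴴ * (u : QuatMat)) 0 1)).re := by
    conv_lhs => rw [← mul_cancel_of_mem_Sp2 hQ.1 (u : QuatMat), reA, Matrix.mul_apply,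
      Fin.sum_univ_two, hξ.2.2, mul_neg, ← sub_eq_add_neg]
  have hT : u ∈ (tangentSpace (levelSet t) Q).comap (tangentSpace Sp2 Q).subtype ↔
      reA u = 0 := by
    rw [Submodule.mem_comap, Submodule.subtype_apply, mem_tangentSpace_levelSet ht ht' hQ]
    exact and_iff_right u.2
  rw [principalSpace, Submodule.mem_inf, hT, and_comm, entries_apply, mem_shapeEigenspace,
    ← hreA, htQ]
  have key : reA u = 0 → (u ∈ Module.End.eigenspace
      (-(leviCivita Sp2 sp2Metric (unitNormal Sp2 sp2Metric reA) Q)) μ ↔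
      gradCoord (Q * (Qᴴ * u)) + invConn (Qᴴ * u) (gradCoord Q)
        = -((μ * √(1 - t ^ 2)) • (Qᴴ * (u : QuatMat)))) := by
    intro hu
    rw [Module.End.mem_eigenspace_iff, LinearMap.neg_apply,
      leviCivita_unitNormal ht ht' hQ u hu, neg_eq_iff_eq_neg, inv_smul_eq_iff₀ hs.ne',
      ← Subtype.coe_inj, leviCivita_riemGradient_reA hQ.1, mul_cancel_of_mem_Sp2 hQ.1]
    have e : ((√(1 - t ^ 2) • -(μ • u) : tangentSpace Sp2 Q) : QuatMat)
        = Q * -((μ * √(1 - t ^ 2)) • (Qᴴ * (u : QuatMat))) := by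
      rw [mul_neg, mul_smul_comm, mul_cancel_of_mem_Sp2 hQ.1, smul_neg, smul_smul, mul_comm μ]
      rfl
    rw [e]
    constructor
    · intro h
      rw [← mul_cancel_of_mem_Sp2' hQ.1 (gradCoord _ + _), h, mul_cancel_of_mem_Sp2' hQ.1]
    · intro h
      rw [h]
  have key' : (gradCoord (Q * (Qᴴ * u)) + invConn (Qᴴ * u) (gradCoord Q)
        = -((μ * √(1 - t ^ 2)) • (Qᴴ * (u : QuatMat)))) ↔
      t • (Qᴴ * (u : QuatMat)) 0 0 = (μ * √(1 - t ^ 2)) • (Qᴴ * (u : QuatMat)) 0 0 ∧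
      t • (Qᴴ * (u : QuatMat)) 0 1 + Q 0 1 * (Qᴴ * (u : QuatMat)) 1 1
        = (μ * √(1 - t ^ 2)) • (Qᴴ * (u : QuatMat)) 0 1 ∧
      (star (Q 0 1) * (Qᴴ * (u : QuatMat)) 0 1).im
        = (μ * √(1 - t ^ 2)) • (Qᴴ * (u : QuatMat)) 1 1 := by
    rw [hessian_eq Q hξ, show reA Q = t from hQ.2]
    generalize Qᴴ * (u : QuatMat) = ξ at hξ
    generalize μ * √(1 - t ^ 2) = m
    constructor
    · intro h
      have h00 := congrArg (fun A : QuatMat => A 0 0) h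
      have h01 := congrArg (fun A : QuatMat => A 0 1) h
      have h11 := congrArg (fun A : QuatMat => A 1 1) h
      simp only [Matrix.neg_apply, Matrix.smul_apply, Matrix.of_apply, Matrix.cons_val',
        Matrix.cons_val_zero, Matrix.cons_val_one, Matrix.cons_val_fin_one] at h00 h01 h11
      refine ⟨?_, ?_, neg_injective h11⟩
      · rw [neg_smul] at h00
        exact neg_injective h00
      · rw [neg_smul, ← neg_add'] at h01
        exact neg_injective h01
    · rintro ⟨h00, h01, h11⟩
      refine sp2_ext ⟨by simp [hξ.1], by simp, rfl⟩ ?_ ?_ ?_ ?_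
      · have := sp2Submodule.neg_mem (sp2Submodule.smul_mem m (mem_sp2Submodule.2 hξ))
        exact mem_sp2Submodule.1 this
      · change -t • ξ 0 0 = -(m • ξ 0 0)
        rw [neg_smul, h00]
      · change -t • ξ 0 1 - Q 0 1 * ξ 1 1 = -(m • ξ 0 1)
        rw [neg_smul, ← neg_add', h01]
      · exact congrArg Neg.neg h11
  constructor
  · rintro ⟨hu, he⟩
    exact ⟨hξ.1, hξ.2.1, hu, key'.1 ((key hu).1 he)⟩
  · rintro ⟨-, -, hu, h⟩
    exact ⟨hu, (key hu).2 (key'.2 h)⟩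

theorem finrank_principalSpace_eq {t : ℝ} (ht : -1 < t) (ht' : t < 1) {Q : QuatMat}
    (hQ : Q ∈ levelSet t) (μ : ℝ) : Module.finrank ℝ
      (principalSpace Sp2 sp2Metric (levelSet t) (unitNormal Sp2 sp2Metric reA) Q μ) =
      Module.finrank ℝ (shapeEigenspace (Q 0 0) (Q 0 1) (μ * √(1 - t ^ 2))) := by
  let P := principalSpace Sp2 sp2Metric (levelSet t) (unitNormal Sp2 sp2Metric reA) Q μ
  let f : P →ₗ[ℝ] ℍ[ℝ] × ℍ[ℝ] × ℍ[ℝ] :=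
    ((entries.comp (LinearMap.mulLeft ℝ Qᴴ)).comp (tangentSpace Sp2 Q).subtype).comp P.subtype
  have hf : ∀ u : P, f u = entries (Qᴴ * ((u : tangentSpace Sp2 Q) : QuatMat)) := fun _ => rfl
  symm
  refine finrank_eq_of_range_eq (f := f) ?_ ?_ ?_
  · intro u v huv
    have hu := (mem_tangentSpace_Sp2 hQ.1).1 (u : tangentSpace Sp2 Q).2
    have hv := (mem_tangentSpace_Sp2 hQ.1).1 (v : tangentSpace Sp2 Q).2
    rw [hf, hf, entries_apply, entries_apply, Prod.mk.injEq, Prod.mk.injEq] at huv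
    have h := sp2_ext hu hv huv.1 huv.2.1 huv.2.2
    apply Subtype.ext
    apply Subtype.ext
    rw [← mul_cancel_of_mem_Sp2 hQ.1 ((u : tangentSpace Sp2 Q) : QuatMat), h,
      mul_cancel_of_mem_Sp2 hQ.1]
  · intro u
    exact (mem_principalSpace_iff ht ht' hQ μ u).1 u.2
  · rintro ⟨x, y, z⟩ hv
    obtain ⟨hx, hz, -⟩ := mem_shapeEigenspace.1 hv
    have hξ : (!![x, y; -star y, z] : QuatMat) ∈ sp2 := ⟨hx, hz, rfl⟩
    have hu : entries (Qᴴ * (Q * !![x, y; -star y, z])) = (x, y, z) := by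
      rw [mul_cancel_of_mem_Sp2' hQ.1]; rfl
    exact ⟨⟨⟨_, mul_mem_tangentSpace_Sp2 hQ.1 hξ⟩,
      (mem_principalSpace_iff ht ht' hQ μ _).2 (hu.symm ▸ hv)⟩, hu⟩

theorem finrank_principalSpace {t : ℝ} (ht : -1 < t) (ht' : t < 1) {Q : QuatMat}
    (hQ : Q ∈ levelSet t) (μ : ℝ) : Module.finrank ℝ
      (principalSpace Sp2 sp2Metric (levelSet t) (unitNormal Sp2 sp2Metric reA) Q μ) =
      ∑ i : Fin 3, if curvatures t Q i = μ then 3 else 0 := by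
  have hs : 0 < √(1 - t ^ 2) := Real.sqrt_pos.2 (by nlinarith)
  have htQ : (Q 0 0).re = t := hQ.2
  have e : ∀ c : ℝ, c / 2 = μ * √(1 - t ^ 2) ↔ c / (2 * √(1 - t ^ 2)) = μ := fun c => by
    rw [← div_div, div_eq_iff hs.ne']
  rw [finrank_principalSpace_eq ht ht' hQ, finrank_shapeEigenspace (first_row_of_mem_Sp2 hQ.1)
    (by rwa [htQ]) (by rwa [htQ]), htQ, Fin.sum_univ_three]
  simp only [curvatures, Matrix.cons_val_zero, Matrix.cons_val_one, Matrix.cons_val, e,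
    div_eq_iff hs.ne']
  congr!

/-- With `r = √(t² + 4|b|²)` and over the denominator `2√(1 - t²)`, the numerators are `2t`, `t + r`
and `t - r`. They collide only if `r = ±t` or `r = 0`, each of which forces `b = 0`; conversely `b =
0` gives `r = ±t`. -/
theorem curvatures_injective_iff {t : ℝ} (ht : -1 < t) (ht' : t < 1) (Q : QuatMat) :
    Function.Injective (curvatures t Q) ↔ Q 0 1 ≠ 0 := by
  have hs : 0 < √(1 - t ^ 2) := Real.sqrt_pos.2 (by nlinarith)
  have h0 : curvatures t Q 0 = (2 * t) / (2 * √(1 - t ^ 2)) := by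
    change t / √(1 - t ^ 2) = _
    rw [mul_div_mul_left _ _ two_ne_zero]
  have h1 : curvatures t Q 1 = (t + √(t ^ 2 + 4 * ‖Q 0 1‖ ^ 2)) / (2 * √(1 - t ^ 2)) := rfl
  have h2 : curvatures t Q 2 = (t - √(t ^ 2 + 4 * ‖Q 0 1‖ ^ 2)) / (2 * √(1 - t ^ 2)) := rfl
  have hr0 := Real.sqrt_nonneg (t ^ 2 + 4 * ‖Q 0 1‖ ^ 2)
  have hr := Real.sq_sqrt (show 0 ≤ t ^ 2 + 4 * ‖Q 0 1‖ ^ 2 by positivity)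
  generalize √(t ^ 2 + 4 * ‖Q 0 1‖ ^ 2) = r at h1 h2 hr0 hr
  have hdiv : ∀ c d : ℝ, c / (2 * √(1 - t ^ 2)) = d / (2 * √(1 - t ^ 2)) ↔ c = d := fun c d =>
    div_left_inj' (by positivity)
  constructor
  · intro hinj hb
    rw [hb, norm_zero] at hr
    rcases eq_or_eq_neg_of_sq_eq_sq r t (by linarith) with h | h
    · have : curvatures t Q 0 = curvatures t Q 1 := by rw [h0, h1, hdiv]; linarith
      exact absurd (hinj this) (by decide)
    · have : curvatures t Q 0 = curvatures t Q 2 := by rw [h0, h2, hdiv]; linarith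
      exact absurd (hinj this) (by decide)
  · intro hb
    have hb' : 0 < ‖Q 0 1‖ ^ 2 := pow_pos (norm_pos_iff.2 hb) 2
    have n01 : curvatures t Q 0 ≠ curvatures t Q 1 := by
      rw [h0, h1, Ne, hdiv]
      intro h
      rw [show r = t by linarith] at hr
      linarith
    have n02 : curvatures t Q 0 ≠ curvatures t Q 2 := by
      rw [h0, h2, Ne, hdiv]
      intro h
      rw [show r = -t by linarith] at hr
      linarith
    have n12 : curvatures t Q 1 ≠ curvatures t Q 2 := by
      rw [h1, h2, Ne, hdiv]
      intro h
      rw [show r = 0 by linarith] at hr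
      nlinarith [sq_nonneg t]
    intro i j hij
    fin_cases i <;> fin_cases j
    exacts [rfl, absurd hij n01, absurd hij n02, absurd hij n01.symm, rfl, absurd hij n12,
      absurd hij n02.symm, absurd hij n12.symm, rfl]

end LevelHypersurfaces

/-! ### Range, critical set and focal submanifolds -/

section FocalSubmanifolds

theorem reA_mem_Icc {Q : QuatMat} (hQ : Q ∈ Sp2) : reA Q ∈ Icc (-1 : ℝ) 1 := by
  have h := first_row_of_mem_Sp2 hQ
  rw [norm_sq_eq] at h
  rw [mem_Icc, ← abs_le, ← sq_le_one_iff_abs_le_one, reA]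
  nlinarith [sq_nonneg (Q 0 0).imI, sq_nonneg (Q 0 0).imJ, sq_nonneg (Q 0 0).imK,
    sq_nonneg ‖Q 0 1‖]

theorem image_reA : reA '' Sp2 = Icc (-1) 1 := by
  refine Subset.antisymm (image_subset_iff.2 fun Q hQ => reA_mem_Icc hQ) fun t ht => ?_
  have hs : √(1 - t ^ 2) * √(1 - t ^ 2) = 1 - t ^ 2 :=
    Real.mul_self_sqrt (by nlinarith [ht.1, ht.2])
  -- A real rotation matrix with cosine `t`.
  refine ⟨!![(t : ℍ[ℝ]), (√(1 - t ^ 2) : ℍ[ℝ]); -(√(1 - t ^ 2) : ℍ[ℝ]), (t : ℍ[ℝ])], ?_, ?_⟩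
  · change _ * _ = _
    ext i j <;> fin_cases i <;> fin_cases j <;>
      simp [Matrix.mul_apply, Fin.sum_univ_two, Matrix.conjTranspose_apply, hs] <;>
      ring
  · simp [reA]

/-- If `(Re a)² = 1`, the unit first row has no room for `Im a` or `b`; orthogonality of the rows
then kills `c`, and `|d| = 1` remains. The parameter `ε` treats both signs at once. -/
theorem levelSet_eq_of_sq_eq_one {ε : ℝ} (hε : ε ^ 2 = 1) :
    levelSet ε = {Q | ∃ d : ℍ[ℝ], ‖d‖ = 1 ∧ Q = !![(ε : ℍ[ℝ]), 0; 0, d]} := by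
  have hεε : ε * ε = 1 := by rw [← pow_two, hε]
  ext Q
  constructor
  · rintro ⟨hQ, ht⟩
    have ht' : (Q 0 0).re = ε := ht
    have h := first_row_of_mem_Sp2 hQ
    rw [norm_sq_eq, ht', hε] at h
    have nI := sq_nonneg (Q 0 0).imI
    have nJ := sq_nonneg (Q 0 0).imJ
    have nK := sq_nonneg (Q 0 0).imK
    have nb := sq_nonneg ‖Q 0 1‖
    have hI : (Q 0 0).imI = 0 := pow_eq_zero_iff two_ne_zero |>.1 (by linarith)
    have hJ : (Q 0 0).imJ = 0 := pow_eq_zero_iff two_ne_zero |>.1 (by linarith)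
    have hK : (Q 0 0).imK = 0 := pow_eq_zero_iff two_ne_zero |>.1 (by linarith)
    have hb : ‖Q 0 1‖ = 0 := pow_eq_zero_iff two_ne_zero |>.1 (by linarith)
    have ha : Q 0 0 = (ε : ℍ[ℝ]) := by ext <;> simp [ht', hI, hJ, hK]
    rw [norm_eq_zero] at hb
    have hQQ : Q * Qᴴ = 1 := hQ
    have h10 := congrArg (fun A : QuatMat => A 1 0) hQQ
    have h11 := congrArg (fun A : QuatMat => (A 1 1).re) hQQ
    simp only [Matrix.mul_apply, Fin.sum_univ_two, Matrix.conjTranspose_apply, ha, hb, star_zero,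
      mul_zero, add_zero, Quaternion.star_coe, Matrix.one_apply_ne (show (1 : Fin 2) ≠ 0 by decide),
      Matrix.one_apply_eq] at h10 h11
    have hε0 : (ε : ℍ[ℝ]) ≠ 0 := fun h0 => by
      have h3 : ε = 0 := congrArg QuaternionAlgebra.re h0
      rw [h3] at hε
      norm_num at hε
    have hc : Q 1 0 = 0 := (mul_eq_zero.1 h10).resolve_right hε0
    rw [hc, zero_mul, zero_add, ← Quaternion.inner_def, real_inner_self_eq_norm_sq,
      Quaternion.re_one] at h11
    refine ⟨Q 1 1, ?_, ?_⟩
    · exact (pow_eq_one_iff_of_nonneg (norm_nonneg _) two_ne_zero).1 h11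
    · ext1 i j
      fin_cases i <;> fin_cases j
      exacts [ha, hb, hc, rfl]
  · rintro ⟨d, hd, rfl⟩
    have hdd : d * star d = 1 := by
      rw [Quaternion.self_mul_star, Quaternion.normSq_eq_norm_mul_self, hd]; simp
    have hεc : (ε : ℍ[ℝ]) * (ε : ℍ[ℝ]) = 1 := by rw [← Quaternion.coe_mul, hεε, Quaternion.coe_one]
    refine ⟨?_, rfl⟩
    change _ * _ = _
    ext1 i j
    fin_cases i <;> fin_cases j <;>
      simp [Matrix.mul_apply, Fin.sum_univ_two, Matrix.conjTranspose_apply, hdd, hεc]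

theorem areDiffeomorphic_sphere_levelSet {ε : ℝ} (hε : ε ^ 2 = 1) :
    AreDiffeomorphic (Metric.sphere (0 : ℍ[ℝ]) 1) (levelSet ε) := by
  rw [levelSet_eq_of_sq_eq_one hε]
  let ψ : QuatMat →L[ℝ] ℍ[ℝ] := LinearMap.toContinuousLinearMap
    { toFun := fun Q => Q 1 1
      map_add' := fun _ _ => rfl
      map_smul' := fun _ _ => rfl }
  let φ : ℍ[ℝ] →L[ℝ] QuatMat := LinearMap.toContinuousLinearMap
    { toFun := fun d => !![0, 0; 0, d]
      map_add' := fun a b => by ext1 i j; fin_cases i <;> fin_cases j <;> simp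
      map_smul' := fun c a => by ext1 i j; fin_cases i <;> fin_cases j <;> simp }
  have hφ : ∀ d, !![(ε : ℍ[ℝ]), 0; 0, 0] + φ d = !![(ε : ℍ[ℝ]), 0; 0, d] := fun d => by
    change _ + !![0, 0; 0, d] = _
    ext1 i j; fin_cases i <;> fin_cases j <;> simp
  refine ⟨fun d => !![(ε : ℍ[ℝ]), 0; 0, 0] + φ d, ψ, (contDiff_const.add φ.contDiff).contDiffOn,
    ψ.contDiff.contDiffOn, fun d hd => ⟨d, mem_sphere_zero_iff_norm.1 hd, hφ d⟩, ?_, ?_, ?_⟩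
  · rintro _ ⟨d, hd, rfl⟩
    exact mem_sphere_zero_iff_norm.2 hd
  · intro d _
    change ψ (_ + φ d) = d
    rw [hφ]; rfl
  · rintro _ ⟨d, hd, rfl⟩
    exact hφ d

theorem one_mem_levelSet : (1 : QuatMat) ∈ levelSet 1 := ⟨one_mem_Sp2, rfl⟩

theorem neg_one_mem_levelSet : (-1 : QuatMat) ∈ levelSet (-1) :=
  ⟨by simp [Sp2], rfl⟩

theorem maxSet_reA : maxSet Sp2 reA = levelSet 1 := by
  ext Q
  refine and_congr_right fun hQ => ⟨fun h => le_antisymm (reA_mem_Icc hQ).2 ?_, fun h Q' hQ' => ?_⟩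
  · rw [← one_mem_levelSet.2]
    exact h one_mem_Sp2
  · rw [mem_ofPred_eq, h]
    exact (reA_mem_Icc hQ').2

theorem minSet_reA : minSet Sp2 reA = levelSet (-1) := by
  ext Q
  refine and_congr_right fun hQ => ⟨fun h => le_antisymm ?_ (reA_mem_Icc hQ).1, fun h Q' hQ' => ?_⟩
  · rw [← neg_one_mem_levelSet.2]
    exact h neg_one_mem_levelSet.1
  · rw [mem_ofPred_eq, h]
    exact (reA_mem_Icc hQ').1

/-- By positivity of the metric, `∇F = 0` exactly when `|∇F|² = 1 - F²` vanishes. -/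
theorem criticalSet_reA : criticalSet Sp2 sp2Metric reA = maxSet Sp2 reA ∪ minSet Sp2 reA := by
  rw [maxSet_reA, minSet_reA]
  ext Q
  have e : ∀ hQ : Q ∈ Sp2, riemGradient Sp2 sp2Metric reA Q = 0 ↔ reA Q = 1 ∨ reA Q = -1 := by
    intro hQ
    have h1 : sp2Metric Q (riemGradient Sp2 sp2Metric reA Q) (riemGradient Sp2 sp2Metric reA Q)
        = 1 - reA Q ^ 2 := gradNormSq_reA hQ
    rw [← mul_self_eq_one_iff, ← pow_two]
    constructor
    · intro h
      rw [h, map_zero] at h1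
      linarith
    · intro h
      by_contra hne
      have := isRiemannianSubmanifold_Sp2.pos Q hQ _
        (isSmoothField_riemGradient_reA.tangent Q ⟨hQ, mem_univ Q⟩) hne
      rw [h1, h, sub_self] at this
      exact lt_irrefl 0 this
  constructor
  · rintro ⟨hQ, h⟩
    exact ((e hQ).1 h).imp (fun h => ⟨hQ, h⟩) fun h => ⟨hQ, h⟩
  · rintro (h | h)
    · exact ⟨h.1, (e h.1).2 (Or.inl h.2)⟩
    · exact ⟨h.1, (e h.1).2 (Or.inr h.2)⟩

/-- A matrix entry as a continuous linear map. -/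
noncomputable def entryL (i j : Fin 2) : QuatMat →L[ℝ] ℍ[ℝ] :=
  LinearMap.toContinuousLinearMap
    { toFun := fun Q => Q i j
      map_add' := fun _ _ => rfl
      map_smul' := fun _ _ => rfl }

theorem entryL_apply (i j : Fin 2) (Q : QuatMat) : entryL i j Q = Q i j := rfl

/-- Near a focal point, the focal variety is a regular level set. -/
theorem isSubmanifoldAt_focal {ε : ℝ} (hε : ε ^ 2 = 1) {Q : QuatMat} (hQ : Q ∈ levelSet ε) :
    IsSubmanifoldAt 3 (levelSet 1 ∪ levelSet (-1)) Q := by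
  have hQ' := hQ
  rw [levelSet_eq_of_sq_eq_one hε] at hQ'
  obtain ⟨d, hd, hQd⟩ := hQ'
  have hε' : ε = 1 ∨ ε = -1 := mul_self_eq_one_iff.1 (by rw [← pow_two, hε])
  -- The target has dimension `4 + 4 + 4 + 1 = 13`, leaving `16 - 13 = 3`.
  let Φ : QuatMat → ℍ[ℝ] × ℍ[ℝ] × ℍ[ℝ] × ℝ := fun x =>
    (entryL 0 0 x, entryL 0 1 x, entryL 1 0 x, ‖entryL 1 1 x‖ ^ 2)
  have hΦQ : Φ Q = ((ε : ℍ[ℝ]), 0, 0, 1) := by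
    have : Φ Q = ((ε : ℍ[ℝ]), 0, 0, ‖d‖ ^ 2) := by rw [hQd]; rfl
    rw [this, hd, one_pow]
  -- This half-space around `Q` contains one focal component and misses the other, so that the union
  -- is locally a single level set of `Φ`.
  have hW : IsOpen {x : QuatMat | 0 < ε * reA x} :=
    isOpen_lt continuous_const (continuous_const.mul (contDiff_reA (n := 0)).continuous)
  refine (regular_level (Φ := Φ) hW (?_ : 0 < ε * reA Q) (fun x hx => ?_) ?_
    ((entryL 0 0).hasFDerivAt.prodMk ((entryL 0 1).hasFDerivAt.prodMk
      ((entryL 1 0).hasFDerivAt.prodMk (entryL 1 1).hasFDerivAt.norm_sq))) ?_ ?_).1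
  · rw [hQ.2, ← pow_two, hε]
    exact one_pos
  · rw [hΦQ]
    have hx' : 0 < ε * reA x := hx
    constructor
    · intro hxM
      have hxε : x ∈ levelSet ε := by
        rcases hε' with h | h <;> rcases hxM with h' | h' <;> rw [h, h'.2] at hx'
        · rwa [h]
        · norm_num at hx'
        · norm_num at hx'
        · rwa [h]
      rw [levelSet_eq_of_sq_eq_one hε] at hxε
      obtain ⟨e, he, rfl⟩ := hxε
      change ((ε : ℍ[ℝ]), (0 : ℍ[ℝ]), (0 : ℍ[ℝ]), ‖e‖ ^ 2) = _
      rw [he, one_pow]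
    · intro h
      simp only [Φ, Prod.mk.injEq, entryL_apply] at h
      have hxε : x ∈ levelSet ε := by
        rw [levelSet_eq_of_sq_eq_one hε]
        refine ⟨x 1 1, (pow_eq_one_iff_of_nonneg (norm_nonneg _) two_ne_zero).1 h.2.2.2, ?_⟩
        ext1 i j
        fin_cases i <;> fin_cases j
        exacts [h.1, h.2.1, h.2.2.1, rfl]
      rcases hε' with h | h
      · exact Or.inl (h ▸ hxε)
      · exact Or.inr (h ▸ hxε)
  · exact ((entryL 0 0).contDiff.prodMk ((entryL 0 1).contDiff.prodMk
      ((entryL 1 0).contDiff.prodMk ((entryL 1 1).contDiff.norm_sq ℝ)))).contDiffAt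
  · rintro ⟨u, v, w, τ⟩
    -- The derivative of `|·|²` at `d` is `2⟨d, ·⟩`, and `|d| = 1`.
    refine ⟨!![u, v; w, (τ / 2) • d], ?_⟩
    refine Prod.ext rfl (Prod.ext rfl (Prod.ext rfl ?_))
    change 2 • inner ℝ (Q 1 1) ((τ / 2) • d) = τ
    rw [show Q 1 1 = d by rw [hQd]; rfl, real_inner_smul_right, real_inner_self_eq_norm_sq, hd]
    simp
    ring
  · rw [finrank_quatMat]; simp [Quaternion.finrank_eq_four]

theorem isProperlyIsoparametric_reA : IsProperlyIsoparametric Sp2 sp2Metric reA := by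
  refine ⟨⟨⟨⟨1, one_mem_Sp2, -1, neg_one_mem_levelSet.1, ?_⟩, contDiff_reA.contDiffOn,
    fun s => 1 - s ^ 2, by fun_prop, fun p hp => gradNormSq_reA hp⟩,
    fun s => -7 * s, by fun_prop, fun p hp => laplacian_reA hp⟩, ?_⟩
  · rw [one_mem_levelSet.2, neg_one_mem_levelSet.2]
    norm_num
  · rw [maxSet_reA, minSet_reA]
    rintro p (hp | hp)
    · exact ⟨3, by rw [finrank_tangentSpace_Sp2 hp.1]; norm_num,
        isSubmanifoldAt_focal (by norm_num) hp⟩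
    · exact ⟨3, by rw [finrank_tangentSpace_Sp2 hp.1]; norm_num,
        isSubmanifoldAt_focal (by norm_num) hp⟩

end FocalSubmanifolds

end EmbeddedGeometry

/-! ### The main theorem -/

theorem mainTheorem3 :
    -- `Sp(2)` with the left invariant metric is a Riemannian manifold with `T_I Sp(2) = 𝔰𝔭(2)`,
    -- and it has a Levi-Civita connection
    (IsRiemannianSubmanifold 10 Sp2 sp2Metric ∧ (tangentSpace Sp2 1 : Set QuatMat) = sp2 ∧
      IsLeviCivita Sp2 sp2Metric (leviCivita Sp2 sp2Metric)) ∧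
    -- `F` is properly isoparametric
    IsProperlyIsoparametric Sp2 sp2Metric reA ∧
    (∀ Q ∈ Sp2, gradNormSq Sp2 sp2Metric reA Q = 1 - reA Q ^ 2) ∧
    (∀ Q ∈ Sp2, laplacian Sp2 sp2Metric reA Q = -7 * reA Q) ∧
    -- the isoparametric hypersurfaces and their principal curvatures with multiplicities
    reA '' Sp2 = Set.Icc (-1) 1 ∧
    (∀ t : ℝ, -1 < t → t < 1 → ∀ Q ∈ levelSet t,
      IsSubmanifoldAt 9 (levelSet t) Q ∧
      (∀ μ : ℝ, Module.finrank ℝ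
          (principalSpace Sp2 sp2Metric (levelSet t) (unitNormal Sp2 sp2Metric reA) Q μ)
        = ∑ i : Fin 3, if curvatures t Q i = μ then 3 else 0) ∧
      (Function.Injective (curvatures t Q) ↔ Q 0 1 ≠ 0)) ∧
    -- the focal submanifolds
    criticalSet Sp2 sp2Metric reA = maxSet Sp2 reA ∪ minSet Sp2 reA ∧
    maxSet Sp2 reA = levelSet 1 ∧ minSet Sp2 reA = levelSet (-1) ∧
    levelSet 1 = {Q | ∃ d : ℍ[ℝ], ‖d‖ = 1 ∧ Q = !![1, 0; 0, d]} ∧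
    levelSet (-1) = {Q | ∃ d : ℍ[ℝ], ‖d‖ = 1 ∧ Q = !![-1, 0; 0, d]} ∧
    AreDiffeomorphic (Metric.sphere (0 : ℍ[ℝ]) 1) (levelSet 1) ∧
    AreDiffeomorphic (Metric.sphere (0 : ℍ[ℝ]) 1) (levelSet (-1)) := by
  have hp := levelSet_eq_of_sq_eq_one (show (1 : ℝ) ^ 2 = 1 by norm_num)
  have hm := levelSet_eq_of_sq_eq_one (show (-1 : ℝ) ^ 2 = 1 by norm_num)
  rw [Quaternion.coe_neg] at hm
  rw [Quaternion.coe_one] at hp hm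
  exact ⟨⟨isRiemannianSubmanifold_Sp2, tangentSpace_Sp2_one, isLeviCivita_leviCivita_Sp2⟩,
    isProperlyIsoparametric_reA, fun Q hQ => gradNormSq_reA hQ, fun Q hQ => laplacian_reA hQ,
    image_reA, fun t ht ht' Q hQ => ⟨(levelSet_regular ht ht' hQ).1,
      finrank_principalSpace ht ht' hQ, curvatures_injective_iff ht ht' Q⟩,
    criticalSet_reA, maxSet_reA, minSet_reA, hp, hm,
    areDiffeomorphic_sphere_levelSet (by norm_num), areDiffeomorphic_sphere_levelSet (by norm_num)⟩
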